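/- **Notation.** Let $d\ge 1$. For $n\in\mathbb N_0^d$ put $|n|=n_1+\dots+n_d$, $\langle n\rangle=(1+|n|^2)^{1/2}$, and let $l_n(x)=\prod_{j=1}^d L_{n_j}(x_j)e^{-x_j/2}$ be the Laguerre functions on $\mathbb R^d_+=(0,\infty)^d$, where $L_k(x)=\sum_{i\le k}(-1)^i\binom{k}{i}\frac{x^i}{i!}$. $\mathcal S(\mathbb R^d_+)$ is the space of all $f\in C^\infty(\mathbb R^d_+)$ all of whose derivatives extend continuously to $[0,\infty)^d$ and for which all seminorms $\sup_{x\in\mathbb R^d_+}x^\beta|\partial^\alpha f(x)|$ are finite, with the topology of these seminorms. $\mathcal S'(\mathbb R^d_+)$ is its dual. Functions and distributions are identified with their formal Laguerre series $\sum_n a_nl_n$, where $a_n(f)=\int_{\mathbb R^d_+} f\,l_n\,dx$ for $f\in\mathcal S(\mathbb R^d_+)$ and $a_n(u)=\langle u,l_n\rangle$ for $u\in\mathcal S'(\mathbb R^d_+)$. Put $\mathcal S'_N=\{u\in\mathcal S'(\mathbb R^d_+):\sup_n|a_n(u)|\langle n\rangle^{-N}<\infty\}$. For $\alpha,h>0$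 let $\mathcal G_{\alpha,h}$ and $\mathcal G'_{\alpha,h}$ be the Banach spaces of formal series $\sum_n a_nl_n$ with finite norm $\sup_n|a_n|e^{h|n|^{1/\alpha}}$ and $\sup_n|a_n|e^{-h|n|^{1/\alpha}}$, respectively. Let $\mathcal G_\alpha=\bigcup_{h>0}\mathcal G_{\alpha,h}$ and $\mathcal G_{0,\alpha}=\bigcap_{h>0}\mathcal G_{\alpha,h}$, and for $T>0$ let $$L^1([0,T];\mathcal S')=\bigcup_{N>0}L^1([0,T];\mathcal S'_N),\quad L^1([0,T];\mathcal G'_{0,\alpha})=\bigcup_{h>0}L^1([0,T];\mathcal G'_{\alpha,h}),\quad L^1([0,T];\mathcal G'_{\alpha})=\bigcap_{h>0}L^1([0,T];\mathcal G'_{\alpha,h}).$$ Unions carry the locally convex inductive limit topology, intersections the projective limit topology. Elements of the $L^1$ spaces are classes, modulo equality almost everywhere, of functions on $[0,T]$ with values in the formal series whose coefficients are measurable. Let $E$ be the Laguerre operator, $E\,l_n=|n|\,l_n$, and let $\rho,c\in\mathbb C$, $r>0$. Let $E^r_{\rho,c}$ be one of the following two operators on formal series (powers are principal branches and $0^r=0$;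 the two agree when $r=1$): * $E^r_{\rho,c}=\rho\,(E+c/\rho)^r$, i.e. $E^r_{\rho,c}\,l_n=\lambda_nl_n$ with $\lambda_n=\rho\,(|n|+c/\rho)^r$; * provided that $\operatorname{Im}(\rho^r)>0$ (which follows from $\operatorname{Im}\rho>0$ if $r\le1$): $E^r_{\rho,c}=(\rho E+c)^r$, i.e. $\lambda_n=(\rho|n|+c)^r$. The propagator sends $f=\sum_na_nl_n$ to the path $t\mapsto e^{-itE^r_{\rho,c}}f=\sum_ne^{-it\lambda_n}a_nl_n$, $t\in[0,T]$. It is called *discontinuous from $X$ to $Y$* if, as a map into $Y$ defined on the subspace of those $f\in X$ whose path belongs to $Y$, it is not continuous; in particular it does not restrict to a continuous map $X\to Y$. **Theorem 4.1.** Let $r,T>0$, $\rho,c\in\mathbb C$ and $\operatorname{Im}\rho>0$. The propagator $f\mapsto e^{-itE^r_{\rho,c}}f$ is discontinuous from $X$ to $Y$ for 1. $X=\mathcal S(\mathbb R^d_+)$ and $Y=L^1([0,T];\mathcal S'(\mathbb R^d_+))$; 2. $X=\mathcal G_{0,\alpha}(\mathbb R^d_+)$ and $Y=L^1([0,T];\mathcal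 G'_{0,\alpha}(\mathbb R^d_+))$, whenever $\alpha>1/r$; 3. $X=\mathcal G_{\alpha}(\mathbb R^d_+)$ and $Y=L^1([0,T];\mathcal G'_{\alpha}(\mathbb R^d_+))$, whenever $\alpha\ge1/r$. Consequently, in each of these cases and for every right-hand side $F$ on $[0,T]$ with values in the formal series, the Cauchy problem $i\partial_tu-E^r_{\rho,c}u=F$ on $[0,T]$, $u(0)=f$ (understood coefficientwise) is ill-posed: there is no continuous map $X\to Y$ that assigns to every $f\in X$ a solution $u\in Y$. -/

import Mathlib

open MeasureTheory Set Filter Topology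
open scoped ENNReal ContDiff

noncomputable section

namespace LaguerreOrthant

/-! ## Multi-indices, the orthant, partial derivatives -/

/-- Multi-indices with `d` entries. -/
abbrev MultiIndex (d : ℕ) : Type := Fin d → ℕ

/-- The length `|n| = n₁ + ⋯ + n_d`. -/
def len {d : ℕ} (n : MultiIndex d) : ℕ := ∑ j, n j

/-- The open orthant `(0, ∞)^d`. -/
def orthant (d : ℕ) : Set (Fin d → ℝ) := {x | ∀ j, 0 < x j}

/-- The closed orthant `[0, ∞)^d`. -/
def closedOrthant (d : ℕ) : Set (Fin d → ℝ) := {x | ∀ j, 0 ≤ x j}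

/-- The partial derivative in the `j`-th coordinate direction. -/
def partialDeriv {d : ℕ} (j : Fin d) (f : (Fin d → ℝ) → ℂ) : (Fin d → ℝ) → ℂ :=
  fun x => fderiv ℝ f x (Pi.single j 1)

/-- The iterated partial derivative `∂^α f`. -/
def iteratedPartial {d : ℕ} (α : MultiIndex d) (f : (Fin d → ℝ) → ℂ) : (Fin d → ℝ) → ℂ :=
  (List.finRange d).foldr (fun j g => (partialDeriv j)^[α j] g) f

/-- The monomial `x^β`. -/
def monomial {d : ℕ} (β : MultiIndex d) (x : Fin d → ℝ) : ℝ := ∏ j, x j ^ β j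

lemma isOpen_orthant (d : ℕ) : IsOpen (orthant d) := by
  have h : orthant d = ⋂ j, {x : Fin d → ℝ | 0 < x j} := by ext x; simp [orthant]
  rw [h]
  exact isOpen_iInter_of_finite fun j => isOpen_lt continuous_const (continuous_apply j)

lemma one_mem_orthant (d : ℕ) : (fun _ => 1 : Fin d → ℝ) ∈ orthant d := fun _ => one_pos

instance (d : ℕ) : Nonempty (orthant d) := ⟨⟨_, one_mem_orthant d⟩⟩

lemma monomial_nonneg {d : ℕ} (β : MultiIndex d) {x : Fin d → ℝ} (hx : x ∈ orthant d) :
    0 ≤ monomial β x := Finset.prod_nonneg fun j _ => pow_nonneg (hx j).le _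

lemma partialDeriv_congr {d : ℕ} (j : Fin d) {f g : (Fin d → ℝ) → ℂ}
    (h : EqOn f g (orthant d)) : EqOn (partialDeriv j f) (partialDeriv j g) (orthant d) := by
  intro x hx
  have : f =ᶠ[𝓝 x] g := h.eventuallyEq_of_mem ((isOpen_orthant d).mem_nhds hx)
  simp only [partialDeriv, this.fderiv_eq]

lemma partialDeriv_contDiffOn {d : ℕ} (j : Fin d) {f : (Fin d → ℝ) → ℂ}
    (h : ContDiffOn ℝ ∞ f (orthant d)) : ContDiffOn ℝ ∞ (partialDeriv j f) (orthant d) :=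
  (h.fderiv_of_isOpen (isOpen_orthant d) (by simp)).clm_apply contDiffOn_const

/-- Two functions related by an operation that commutes with partial derivatives on the orthant
stay related after any iterated partial derivative. -/
lemma iteratedPartial_induction {d : ℕ} (P : ((Fin d → ℝ) → ℂ) → Prop)
    (hP : ∀ j f, P f → P (partialDeriv j f)) (α : MultiIndex d) (f : (Fin d → ℝ) → ℂ) (hf : P f) :
    P (iteratedPartial α f) := by
  unfold iteratedPartial
  induction List.finRange d with
  | nil => exact hf
  | cons j l ih =>
    simp only [List.foldr_cons]
    induction α j with
    | zero => exact ih
    | succ k ihk => rw [Function.iterate_succ_apply']; exact hP _ _ ihk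

lemma iteratedPartial_contDiffOn {d : ℕ} (α : MultiIndex d) {f : (Fin d → ℝ) → ℂ}
    (h : ContDiffOn ℝ ∞ f (orthant d)) : ContDiffOn ℝ ∞ (iteratedPartial α f) (orthant d) :=
  iteratedPartial_induction (fun g => ContDiffOn ℝ ∞ g (orthant d))
    (fun j _ hg => partialDeriv_contDiffOn j hg) α f h

lemma iteratedPartial_add {d : ℕ} (α : MultiIndex d) {f g : (Fin d → ℝ) → ℂ}
    (hf : ContDiffOn ℝ ∞ f (orthant d)) (hg : ContDiffOn ℝ ∞ g (orthant d)) :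
    EqOn (iteratedPartial α (f + g)) (iteratedPartial α f + iteratedPartial α g) (orthant d) := by
  have key : ∀ l : List (Fin d),
      ContDiffOn ℝ ∞ (l.foldr (fun j g => (partialDeriv j)^[α j] g) f) (orthant d) ∧
      ContDiffOn ℝ ∞ (l.foldr (fun j g => (partialDeriv j)^[α j] g) g) (orthant d) ∧
      EqOn (l.foldr (fun j g => (partialDeriv j)^[α j] g) (f + g))
        (l.foldr (fun j g => (partialDeriv j)^[α j] g) f +
          l.foldr (fun j g => (partialDeriv j)^[α j] g) g) (orthant d) := by
    intro l
    induction l with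
    | nil => exact ⟨hf, hg, fun _ _ => rfl⟩
    | cons j l ih =>
      simp only [List.foldr_cons]
      induction α j with
      | zero => exact ih
      | succ k ihk =>
        simp only [Function.iterate_succ_apply']
        obtain ⟨h1, h2, h3⟩ := ihk
        refine ⟨partialDeriv_contDiffOn j h1, partialDeriv_contDiffOn j h2, ?_⟩
        refine (partialDeriv_congr j h3).trans fun x hx => ?_
        have hn := (isOpen_orthant d).mem_nhds hx
        have d1 := (h1.contDiffAt hn).differentiableAt (by simp)
        have d2 := (h2.contDiffAt hn).differentiableAt (by simp)
        simp only [partialDeriv, Pi.add_apply]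
        rw [fderiv_add d1 d2]
        rfl
  exact (key _).2.2

lemma iteratedPartial_smul {d : ℕ} (α : MultiIndex d) (a : ℂ) {f : (Fin d → ℝ) → ℂ}
    (hf : ContDiffOn ℝ ∞ f (orthant d)) :
    EqOn (iteratedPartial α (a • f)) (a • iteratedPartial α f) (orthant d) := by
  have key : ∀ l : List (Fin d),
      ContDiffOn ℝ ∞ (l.foldr (fun j g => (partialDeriv j)^[α j] g) f) (orthant d) ∧
      EqOn (l.foldr (fun j g => (partialDeriv j)^[α j] g) (a • f))
        (a • l.foldr (fun j g => (partialDeriv j)^[α j] g) f) (orthant d) := by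
    intro l
    induction l with
    | nil => exact ⟨hf, fun _ _ => rfl⟩
    | cons j l ih =>
      simp only [List.foldr_cons]
      induction α j with
      | zero => exact ih
      | succ k ihk =>
        simp only [Function.iterate_succ_apply']
        obtain ⟨h1, h3⟩ := ihk
        refine ⟨partialDeriv_contDiffOn j h1, ?_⟩
        refine (partialDeriv_congr j h3).trans fun x hx => ?_
        have hn := (isOpen_orthant d).mem_nhds hx
        have d1 := (h1.contDiffAt hn).differentiableAt (by simp)
        simp only [partialDeriv, Pi.smul_apply]
        rw [fderiv_const_smul d1 a]
        rfl
  exact (key _).2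

/-! ## The Schwartz space on the orthant -/

/-- Smooth functions on the open orthant (set to zero outside it), all of whose partial
derivatives extend continuously to the closed orthant, with `sup x^β |∂^α f(x)| < ∞` for all
multi-indices `α`, `β`. -/
def schwartzSubmodule (d : ℕ) : Submodule ℂ ((Fin d → ℝ) → ℂ) where
  carrier := {f | (∀ x ∉ orthant d, f x = 0) ∧ ContDiffOn ℝ ∞ f (orthant d) ∧
    (∀ α, ∃ g, ContinuousOn g (closedOrthant d) ∧ EqOn g (iteratedPartial α f) (orthant d)) ∧
    ∀ α β, ∃ C : ℝ, ∀ x ∈ orthant d, monomial β x * ‖iteratedPartial α f x‖ ≤ C}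
  zero_mem' := by
    have hz : ContDiffOn ℝ ∞ (0 : (Fin d → ℝ) → ℂ) (orthant d) := contDiffOn_const
    have h0 : ∀ α, EqOn (iteratedPartial α (0 : (Fin d → ℝ) → ℂ)) 0 (orthant d) := by
      intro α x hx
      have := iteratedPartial_smul α 0 hz hx
      simpa using this
    exact ⟨fun _ _ => rfl, hz, fun α => ⟨0, continuousOn_const, (h0 α).symm⟩,
      fun α β => ⟨0, fun x hx => by simp [h0 α hx]⟩⟩
  add_mem' := by
    rintro f g ⟨f0, f1, f2, f3⟩ ⟨g0, g1, g2, g3⟩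
    refine ⟨fun x hx => by simp [f0 x hx, g0 x hx], f1.add g1, fun α => ?_, fun α β => ?_⟩
    · obtain ⟨u, hu, hu'⟩ := f2 α
      obtain ⟨v, hv, hv'⟩ := g2 α
      refine ⟨u + v, hu.add hv, fun x hx => ?_⟩
      rw [iteratedPartial_add α f1 g1 hx]
      simp [hu' hx, hv' hx]
    · obtain ⟨C, hC⟩ := f3 α β
      obtain ⟨D, hD⟩ := g3 α β
      refine ⟨C + D, fun x hx => ?_⟩
      rw [iteratedPartial_add α f1 g1 hx]
      calc monomial β x * ‖(iteratedPartial α f + iteratedPartial α g) x‖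
          ≤ monomial β x * (‖iteratedPartial α f x‖ + ‖iteratedPartial α g x‖) :=
            mul_le_mul_of_nonneg_left (norm_add_le _ _) (monomial_nonneg β hx)
        _ ≤ C + D := by rw [mul_add]; exact add_le_add (hC x hx) (hD x hx)
  smul_mem' := by
    rintro a f ⟨f0, f1, f2, f3⟩
    refine ⟨fun x hx => by simp [f0 x hx], contDiffOn_const.smul f1, fun α => ?_, fun α β => ?_⟩
    · obtain ⟨u, hu, hu'⟩ := f2 α
      refine ⟨a • u, continuousOn_const.smul hu, fun x hx => ?_⟩
      rw [iteratedPartial_smul α a f1 hx]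
      simp [hu' hx]
    · obtain ⟨C, hC⟩ := f3 α β
      refine ⟨‖a‖ * C, fun x hx => ?_⟩
      rw [iteratedPartial_smul α a f1 hx, Pi.smul_apply, norm_smul, mul_left_comm]
      exact mul_le_mul_of_nonneg_left (hC x hx) (norm_nonneg _)

/-- The Schwartz space `𝒮(ℝ^d_+)`. -/
def Schwartz (d : ℕ) : Type := schwartzSubmodule d

instance (d : ℕ) : AddCommGroup (Schwartz d) := inferInstanceAs (AddCommGroup (schwartzSubmodule d))

instance (d : ℕ) : Module ℂ (Schwartz d) := inferInstanceAs (Module ℂ (schwartzSubmodule d))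

/-- The function underlying an element of `𝒮(ℝ^d_+)`. -/
def Schwartz.toFun {d : ℕ} (f : Schwartz d) : (Fin d → ℝ) → ℂ := f.1

lemma Schwartz.contDiffOn {d : ℕ} (f : Schwartz d) : ContDiffOn ℝ ∞ f.toFun (orthant d) := f.2.2.1

lemma Schwartz.bddAbove {d : ℕ} (f : Schwartz d) (α β : MultiIndex d) :
    BddAbove (range fun x : orthant d => monomial β x * ‖iteratedPartial α f.toFun x‖) := by
  obtain ⟨C, hC⟩ := f.2.2.2.2 α β
  exact ⟨C, by rintro _ ⟨x, rfl⟩; exact hC x x.2⟩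

/-- The seminorms `μ_{α,β}(f) = sup_x x^β |∂^α f(x)|`, the supremum over the open orthant. -/
def schwartzSeminorm (d : ℕ) : SeminormFamily ℂ (Schwartz d) (MultiIndex d × MultiIndex d) :=
  fun p => Seminorm.ofSMulLE
    (fun f => ⨆ x : orthant d, monomial p.2 x * ‖iteratedPartial p.1 f.toFun x‖)
    (by
      have h0 : ∀ x ∈ orthant d, iteratedPartial p.1 (0 : Schwartz d).toFun x = 0 := by
        intro x hx
        have h := iteratedPartial_smul p.1 0 (Schwartz.contDiffOn (0 : Schwartz d)) hx
        have e : (0 : ℂ) • (0 : Schwartz d).toFun = (0 : Schwartz d).toFun := by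
          rw [zero_smul]; rfl
        rw [e] at h
        simpa using h
      simp [fun x : orthant d => h0 x x.2])
    (by
      intro f g
      refine ciSup_le fun x => ?_
      have h := iteratedPartial_add p.1 f.contDiffOn g.contDiffOn x.2
      change monomial p.2 x * ‖iteratedPartial p.1 (f.toFun + g.toFun) x‖ ≤ _
      rw [h]
      refine (mul_le_mul_of_nonneg_left (norm_add_le _ _) (monomial_nonneg p.2 x.2)).trans ?_
      rw [mul_add]
      exact add_le_add (le_ciSup (f.bddAbove p.1 p.2) x) (le_ciSup (g.bddAbove p.1 p.2) x))
    (by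
      intro a f
      refine ciSup_le fun x => ?_
      have h := iteratedPartial_smul p.1 a f.contDiffOn x.2
      change monomial p.2 x * ‖iteratedPartial p.1 (a • f.toFun) x‖ ≤ _
      rw [h, Pi.smul_apply, norm_smul, mul_left_comm]
      exact mul_le_mul_of_nonneg_left (le_ciSup (f.bddAbove p.1 p.2) x) (norm_nonneg _))

instance (d : ℕ) : TopologicalSpace (Schwartz d) := (schwartzSeminorm d).moduleFilterBasis.topology

lemma schwartz_withSeminorms (d : ℕ) : WithSeminorms (schwartzSeminorm d) := ⟨rfl⟩

instance (d : ℕ) : IsTopologicalAddGroup (Schwartz d) :=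
  (schwartz_withSeminorms d).topologicalAddGroup

instance (d : ℕ) : ContinuousSMul ℂ (Schwartz d) := (schwartz_withSeminorms d).continuousSMul

/-! ## Laguerre functions -/

/-- The Laguerre polynomial `L_n(x) = ∑_{k ≤ n} (-1)^k (n choose k) x^k / k!`. -/
def laguerrePoly (n : ℕ) : Polynomial ℝ :=
  ∑ k ∈ Finset.range (n + 1),
    Polynomial.monomial k ((-1) ^ k * (n.choose k : ℝ) / (k.factorial : ℝ))

/-- The Laguerre function `l_n(x) = ∏_j L_{n_j}(x_j) e^{-x_j/2}`. -/
def laguerreFun {d : ℕ} (n : MultiIndex d) (x : Fin d → ℝ) : ℝ :=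
  ∏ j, (laguerrePoly (n j)).eval (x j) * Real.exp (-(x j) / 2)

/-- Products `∏_j p_j(x_j) e^{-x_j/2}`, a class closed under partial derivatives. -/
def expPoly {d : ℕ} (p : Fin d → Polynomial ℝ) (x : Fin d → ℝ) : ℂ :=
  ((∏ j, (p j).eval (x j) * Real.exp (-(x j) / 2) : ℝ) : ℂ)

lemma expPoly_contDiff {d : ℕ} (p : Fin d → Polynomial ℝ) : ContDiff ℝ ∞ (expPoly p) := by
  unfold expPoly
  have h : ContDiff ℝ ∞ fun x : Fin d → ℝ => ∏ j, (p j).eval (x j) * Real.exp (-(x j) / 2) := by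
    refine contDiff_prod fun j _ => ContDiff.mul ?_ ?_
    · have h0 : ContDiff ℝ ∞ fun t : ℝ => (p j).eval t := by
        simpa using (p j).contDiff_aeval (𝕜 := ℝ) ∞
      exact h0.comp (contDiff_apply ℝ ℝ j)
    · exact Real.contDiff_exp.comp (((contDiff_apply ℝ ℝ j).neg).div_const 2)
  exact Complex.ofRealCLM.contDiff.comp h

lemma partialDeriv_expPoly {d : ℕ} (j : Fin d) (p : Fin d → Polynomial ℝ) :
    partialDeriv j (expPoly p) =
      expPoly (Function.update p j ((p j).derivative - Polynomial.C (1 / 2) * p j)) := by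
  funext x
  have hdiff : DifferentiableAt ℝ (expPoly p) x :=
    (expPoly_contDiff p).contDiffAt.differentiableAt (by simp)
  have hline : HasDerivAt (fun t : ℝ => Function.update x j t) (Pi.single j (1 : ℝ)) (x j) :=
    hasDerivAt_update x j (x j)
  have h1 : HasDerivAt (fun t : ℝ => expPoly p (Function.update x j t))
      (partialDeriv j (expPoly p) x) (x j) := by
    have hd : HasFDerivAt (expPoly p) (fderiv ℝ (expPoly p) x) (Function.update x j (x j)) := by
      rw [Function.update_eq_self]; exact hdiff.hasFDerivAt
    exact hd.comp_hasDerivAt (x j) hline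
  have split : ∀ (q : Fin d → Polynomial ℝ) (t : ℝ), expPoly q (Function.update x j t) =
      (((q j).eval t * Real.exp (-t / 2) *
        ∏ i ∈ Finset.univ.erase j, (q i).eval (x i) * Real.exp (-(x i) / 2) : ℝ) : ℂ) := by
    intro q t
    unfold expPoly
    rw [← Finset.mul_prod_erase _ _ (Finset.mem_univ j)]
    simp only [Function.update_self]
    congr 2
    refine Finset.prod_congr rfl fun i hi => ?_
    rw [Function.update_of_ne (Finset.ne_of_mem_erase hi)]
  set K : ℝ := ∏ i ∈ Finset.univ.erase j, (p i).eval (x i) * Real.exp (-(x i) / 2) with hK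
  have h2 : HasDerivAt (fun t : ℝ => expPoly p (Function.update x j t))
      ((((p j).derivative - Polynomial.C (1 / 2) * p j).eval (x j) *
        Real.exp (-(x j) / 2) * K : ℝ) : ℂ) (x j) := by
    have e1 : HasDerivAt (fun t : ℝ => Real.exp (-t / 2))
        (Real.exp (-(x j) / 2) * (-1 / 2)) (x j) :=
      (((hasDerivAt_id (x j)).neg).div_const 2).exp
    have e2 := (((p j).hasDerivAt (x j)).mul e1).mul_const K
    have e3 := e2.ofReal_comp
    rw [funext (split p)]
    have e4 : ((p j).derivative - Polynomial.C (1 / 2) * p j).eval (x j) *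
        Real.exp (-(x j) / 2) * K = ((p j).derivative.eval (x j) * Real.exp (-(x j) / 2) +
          (p j).eval (x j) * (Real.exp (-(x j) / 2) * (-1 / 2))) * K := by
      simp only [Polynomial.eval_sub, Polynomial.eval_mul, Polynomial.eval_C]
      ring
    rw [e4]
    exact e3
  rw [h1.unique h2]
  have := split (Function.update p j ((p j).derivative - Polynomial.C (1 / 2) * p j)) (x j)
  rw [Function.update_eq_self] at this
  rw [this]
  simp only [Function.update_self, hK]
  congr 2
  refine Finset.prod_congr rfl fun i hi => ?_
  rw [Function.update_of_ne (Finset.ne_of_mem_erase hi)]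

lemma exists_bound_poly_exp (q : Polynomial ℝ) :
    ∃ C : ℝ, ∀ x : ℝ, 0 < x → |q.eval x| * Real.exp (-x / 2) ≤ C := by
  have h := (q.comp (Polynomial.C 2 * Polynomial.X)).tendsto_div_exp_atTop
  have h' : Tendsto (fun x : ℝ => |q.eval x| * Real.exp (-x / 2)) atTop (𝓝 0) := by
    have h2 := (h.comp (tendsto_id.atTop_div_const (two_pos : (0 : ℝ) < 2))).abs
    simp only [abs_zero] at h2
    refine h2.congr fun x => ?_
    simp only [Function.comp, id, Polynomial.eval_comp, Polynomial.eval_mul, Polynomial.eval_C,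
      Polynomial.eval_X, abs_div, Real.abs_exp, neg_div, Real.exp_neg]
    rw [div_eq_mul_inv, mul_div_cancel₀ x (two_ne_zero)]
  obtain ⟨A, hA⟩ := eventually_atTop.1 (h'.eventually (ge_mem_nhds (zero_lt_one)))
  have hc : Continuous fun x : ℝ => |q.eval x| * Real.exp (-x / 2) := by fun_prop
  obtain ⟨B, hB⟩ := (isCompact_Icc (a := (0 : ℝ)) (b := A)).bddAbove_image hc.continuousOn
  refine ⟨max 1 B, fun x hx => ?_⟩
  rcases le_total A x with hx' | hx'
  · exact (hA x hx').trans (le_max_left _ _)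
  · exact (hB ⟨x, ⟨hx.le, hx'⟩, rfl⟩).trans (le_max_right _ _)

lemma exists_bound_expPoly {d : ℕ} (β : MultiIndex d) (p : Fin d → Polynomial ℝ) :
    ∃ C : ℝ, ∀ x ∈ orthant d, monomial β x * ‖expPoly p x‖ ≤ C := by
  choose C hC using fun j => exists_bound_poly_exp (Polynomial.X ^ β j * p j)
  refine ⟨∏ j, C j, fun x hx => ?_⟩
  have e : monomial β x * ‖expPoly p x‖ =
      ∏ j, |(Polynomial.X ^ β j * p j).eval (x j)| * Real.exp (-(x j) / 2) := by
    unfold monomial expPoly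
    rw [Complex.norm_real, Real.norm_eq_abs, Finset.abs_prod, ← Finset.prod_mul_distrib]
    refine Finset.prod_congr rfl fun j _ => ?_
    simp only [Polynomial.eval_mul, Polynomial.eval_pow, Polynomial.eval_X, abs_mul, abs_pow,
      Real.abs_exp, abs_of_pos (hx j)]
    ring
  rw [e]
  exact Finset.prod_le_prod (fun j _ => by positivity) fun j _ => hC j (x j) (hx j)

lemma laguerre_mem (d : ℕ) (n : MultiIndex d) :
    (orthant d).indicator (fun x => (laguerreFun n x : ℂ)) ∈ schwartzSubmodule d := by
  have e : EqOn ((orthant d).indicator (fun x => (laguerreFun n x : ℂ)))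
      (expPoly fun j => laguerrePoly (n j)) (orthant d) := fun x hx => indicator_of_mem hx _
  have key : ∀ α, ∃ p, EqOn
      (iteratedPartial α ((orthant d).indicator (fun x => (laguerreFun n x : ℂ))))
      (expPoly p) (orthant d) := by
    intro α
    refine iteratedPartial_induction (fun f => ∃ p, EqOn f (expPoly p) (orthant d)) ?_ α _ ⟨_, e⟩
    rintro j f ⟨p, hp⟩
    exact ⟨_, (partialDeriv_congr j hp).trans fun x _ => congrFun (partialDeriv_expPoly j p) x⟩
  refine ⟨fun x hx => indicator_of_notMem hx _, ?_, fun α => ?_, fun α β => ?_⟩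
  · exact ((expPoly_contDiff _).contDiffOn).congr e
  · obtain ⟨p, hp⟩ := key α
    exact ⟨expPoly p, (expPoly_contDiff p).continuous.continuousOn, hp.symm⟩
  · obtain ⟨p, hp⟩ := key α
    obtain ⟨C, hC⟩ := exists_bound_expPoly β p
    exact ⟨C, fun x hx => by rw [hp hx]; exact hC x hx⟩

/-- The Laguerre function `l_n` as an element of `𝒮(ℝ^d_+)`. -/
def laguerre {d : ℕ} (n : MultiIndex d) : Schwartz d :=
  ⟨(orthant d).indicator (fun x => (laguerreFun n x : ℂ)), laguerre_mem d n⟩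

/-! ## Formal Laguerre series

A formal series `∑ a_n l_n` is given by its coefficients `(a_n)`. A Schwartz function, a tempered
distribution on the orthant, or an ultradistribution is identified with its Laguerre series. -/

/-- The space `𝒢'_0(ℝ^d_+)` of all formal Laguerre series. -/
abbrev FormalSeries (d : ℕ) : Type := MultiIndex d → ℂ

/-- The Laguerre coefficients `a_n(f) = ∫ f l_n` of a Schwartz function. -/
def Schwartz.coeff {d : ℕ} (f : Schwartz d) : FormalSeries d :=
  fun n => ∫ x in orthant d, f.toFun x * (laguerreFun n x : ℂ)

/-- The Laguerre series `∑ ⟨u, l_n⟩ l_n` of the elements `u` of the dual `𝒮'(ℝ^d_+)`. -/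
def temperedSeries (d : ℕ) : Submodule ℂ (FormalSeries d) :=
  LinearMap.range
    ({ toFun := fun u n => u (laguerre n)
       map_add' := fun _ _ => rfl
       map_smul' := fun _ _ => rfl } : (Schwartz d →L[ℂ] ℂ) →ₗ[ℂ] FormalSeries d)

/-! ## Unions and intersections of normed spaces -/

/-- A seminorm with values in `[0, ∞]`. The vectors at which it is finite form a normed space. -/
structure ExtSeminorm (E : Type*) [AddCommGroup E] [Module ℂ E] where
  toFun : E → ℝ≥0∞
  map_zero : toFun 0 = 0
  map_add_le : ∀ x y, toFun (x + y) ≤ toFun x + toFun y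
  map_smul_le : ∀ (a : ℂ) x, toFun (a • x) ≤ ‖a‖ₑ * toFun x

namespace ExtSeminorm

variable {E : Type*} [AddCommGroup E] [Module ℂ E]

/-- The space of all vectors at which the extended seminorm is finite. -/
def finite (q : ExtSeminorm E) : Submodule ℂ E where
  carrier := {x | q.toFun x < ⊤}
  zero_mem' := by simp [q.map_zero]
  add_mem' := fun {x y} hx hy => (q.map_add_le x y).trans_lt (ENNReal.add_lt_top.2 ⟨hx, hy⟩)
  smul_mem' := fun a x hx => (q.map_smul_le a x).trans_lt (ENNReal.mul_lt_top enorm_lt_top hx)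

/-- The extended seminorm that is infinite outside the subspace `V`. -/
def restrict (q : ExtSeminorm E) (V : Submodule ℂ E) : ExtSeminorm E where
  toFun := fun x => by classical exact if x ∈ V then q.toFun x else ⊤
  map_zero := by simp [q.map_zero]
  map_add_le := by
    intro x y
    by_cases hx : x ∈ V
    · by_cases hy : y ∈ V
      · simpa [hx, hy, V.add_mem hx hy] using q.map_add_le x y
      · simp [hy]
    · simp [hx]
  map_smul_le := by
    intro a x
    by_cases hx : x ∈ V
    · simpa [hx, V.smul_mem a hx] using q.map_smul_le a x
    · by_cases ha : a = 0
      · simp [ha, q.map_zero]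
      · simp [hx, ha]

end ExtSeminorm

section Limits

variable {E : Type*} [AddCommGroup E] [Module ℂ E] (q : Ioi (0 : ℝ) → ExtSeminorm E)

/-- The intersection of the normed spaces `{x | q_h x < ∞}`, `h > 0`. -/
def ProjLimit : Type _ := (⨅ h, (q h).finite : Submodule ℂ E)

instance : AddCommGroup (ProjLimit q) :=
  inferInstanceAs (AddCommGroup (⨅ h, (q h).finite : Submodule ℂ E))

instance : Module ℂ (ProjLimit q) :=
  inferInstanceAs (Module ℂ (⨅ h, (q h).finite : Submodule ℂ E))

/-- The inclusion of the intersection into the ambient space. -/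
def ProjLimit.emb (x : ProjLimit q) : E := x.1

/-- The norms `q_h` on the intersection. -/
def projSeminorm : SeminormFamily ℂ (ProjLimit q) (Ioi (0 : ℝ)) :=
  fun h => Seminorm.ofSMulLE (fun x => ((q h).toFun (x.emb q)).toReal)
    (by change ((q h).toFun 0).toReal = 0; simp [(q h).map_zero])
    (by
      intro x y
      have hx : (q h).toFun (x.emb q) < ⊤ := (Submodule.mem_iInf _).1 x.2 h
      have hy : (q h).toFun (y.emb q) < ⊤ := (Submodule.mem_iInf _).1 y.2 h
      rw [← ENNReal.toReal_add hx.ne hy.ne]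
      exact ENNReal.toReal_mono (ENNReal.add_lt_top.2 ⟨hx, hy⟩).ne ((q h).map_add_le _ _))
    (by
      intro a x
      have hx : (q h).toFun (x.emb q) < ⊤ := (Submodule.mem_iInf _).1 x.2 h
      rw [← toReal_enorm a, ← ENNReal.toReal_mul]
      exact ENNReal.toReal_mono (ENNReal.mul_lt_top enorm_lt_top hx).ne ((q h).map_smul_le _ _))

instance : Nonempty (Ioi (0 : ℝ)) := ⟨⟨1, mem_Ioi.2 one_pos⟩⟩

/-- The projective limit topology. -/
instance : TopologicalSpace (ProjLimit q) := (projSeminorm q).moduleFilterBasis.topology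

/-- The span of the normed spaces `{x | q_h x < ∞}`, `h > 0`; for a family that is monotone in `h`,
as all families below are, it is their union. -/
def IndLimit : Type _ := (⨆ h, (q h).finite : Submodule ℂ E)

instance : AddCommGroup (IndLimit q) :=
  inferInstanceAs (AddCommGroup (⨆ h, (q h).finite : Submodule ℂ E))

instance : Module ℂ (IndLimit q) :=
  inferInstanceAs (Module ℂ (⨆ h, (q h).finite : Submodule ℂ E))

/-- The inclusion of the union into the ambient space. -/
def IndLimit.emb (x : IndLimit q) : E := x.1

/-- The seminorms on the union whose restriction to each of the normed spaces is continuous. -/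
def IndSeminorm : Type _ :=
  {p : Seminorm ℂ (IndLimit q) //
    ∀ h, ∃ C : ℝ, ∀ x : IndLimit q, (q h).toFun (x.emb q) < ⊤ →
      p x ≤ C * ((q h).toFun (x.emb q)).toReal}

instance : Nonempty (IndSeminorm q) := ⟨⟨0, fun _ => ⟨0, fun x _ => by simp⟩⟩⟩

/-- The family of all those seminorms. -/
def indSeminorm : SeminormFamily ℂ (IndLimit q) (IndSeminorm q) := fun p => p.1

/-- The (locally convex) inductive limit topology: it is generated by all seminorms that are
continuous on each of the normed spaces. -/
instance : TopologicalSpace (IndLimit q) := (indSeminorm q).moduleFilterBasis.topology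

end Limits

/-! ## The spaces of Laguerre series -/

/-- The extended norm `sup_n |a_n| w_n` of a formal series. -/
def seriesNorm {d : ℕ} (w : MultiIndex d → ℝ) : ExtSeminorm (FormalSeries d) where
  toFun := fun a => ⨆ n, ‖a n‖ₑ * ENNReal.ofReal (w n)
  map_zero := by simp
  map_add_le := by
    intro a b
    refine iSup_le fun n => ?_
    refine (mul_le_mul_left (enorm_add_le (a n) (b n)) _).trans ?_
    rw [add_mul]
    exact add_le_add (le_iSup (fun n => ‖a n‖ₑ * ENNReal.ofReal (w n)) n)
      (le_iSup (fun n => ‖b n‖ₑ * ENNReal.ofReal (w n)) n)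
  map_smul_le := by
    intro c a
    refine iSup_le fun n => ?_
    rw [Pi.smul_apply, enorm_smul, mul_assoc]
    exact mul_le_mul_right (le_iSup (fun n => ‖a n‖ₑ * ENNReal.ofReal (w n)) n) _

/-- The weight `e^{h |n|^{1/α}}`. -/
def growWeight (d : ℕ) (α : ℝ) (h : Ioi (0 : ℝ)) (n : MultiIndex d) : ℝ :=
  Real.exp (h * (len n : ℝ) ^ (1 / α))

/-- The weight `e^{-h |n|^{1/α}}`. -/
def decayWeight (d : ℕ) (α : ℝ) (h : Ioi (0 : ℝ)) (n : MultiIndex d) : ℝ :=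
  Real.exp (-(h * (len n : ℝ) ^ (1 / α)))

/-- The weight `⟨n⟩^{-N} = (1 + |n|²)^{-N/2}`. -/
def polyWeight (d : ℕ) (N : Ioi (0 : ℝ)) (n : MultiIndex d) : ℝ :=
  (Real.sqrt (1 + (len n : ℝ) ^ 2)) ^ (-(N : ℝ))

/-- `𝒢_α(ℝ^d_+)`, the union over `h > 0` of `𝒢_{α,h} = {∑ a_n l_n : sup |a_n| e^{h|n|^{1/α}} < ∞}`
with the inductive limit topology. -/
abbrev GRoumieu (d : ℕ) (α : ℝ) : Type := IndLimit fun h => seriesNorm (growWeight d α h)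

/-- `𝒢_{0,α}(ℝ^d_+)`, the intersection of the same spaces with the projective limit topology. -/
abbrev GBeurling (d : ℕ) (α : ℝ) : Type := ProjLimit fun h => seriesNorm (growWeight d α h)

/-! ## The spaces `L¹([0,T]; ·)` -/

/-- Measurable functions `[0,T] → 𝒢'_0`, modulo equality almost everywhere (measurability is that
of all Laguerre coefficients). -/
abbrev SeriesPath (d : ℕ) (T : ℝ) : Type :=
  ℝ →ₘ[volume.restrict (Icc 0 T)] (FormalSeries d)

/-- The extended norm `∫_0^T ‖G(t)‖ dt` with `‖a‖ = sup_n |a_n| w_n`. -/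
def pathNorm (d : ℕ) (T : ℝ) (w : MultiIndex d → ℝ) : ExtSeminorm (SeriesPath d T) where
  toFun := fun G => ∫⁻ t in Icc 0 T, (seriesNorm w).toFun (G t)
  map_zero := by
    rw [lintegral_congr_ae (g := fun _ => 0)]
    · simp
    · filter_upwards [AEEqFun.coeFn_zero (α := ℝ) (β := FormalSeries d)
        (μ := volume.restrict (Icc 0 T))] with t ht
      rw [ht]
      exact (seriesNorm w).map_zero
  map_add_le := by
    intro G H
    have hm : AEMeasurable (fun t => (seriesNorm w).toFun (G t)) (volume.restrict (Icc 0 T)) := by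
      refine AEMeasurable.iSup fun n => AEMeasurable.mul_const ?_ _
      exact (((continuous_apply n).comp_aestronglyMeasurable G.aestronglyMeasurable)).enorm
    rw [← lintegral_add_left' hm]
    refine lintegral_mono_ae ?_
    filter_upwards [AEEqFun.coeFn_add G H] with t ht
    rw [ht]
    exact (seriesNorm w).map_add_le _ _
  map_smul_le := by
    intro a G
    rw [← lintegral_const_mul' _ _ enorm_ne_top]
    refine lintegral_mono_ae ?_
    filter_upwards [AEEqFun.coeFn_smul a G] with t ht
    rw [ht]
    exact (seriesNorm w).map_smul_le _ _

/-- The paths with values in the tempered distributions on the orthant. -/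
def temperedPaths (d : ℕ) (T : ℝ) : Submodule ℂ (SeriesPath d T) where
  carrier := {G | ∀ᵐ t ∂(volume.restrict (Icc 0 T)), G t ∈ temperedSeries d}
  zero_mem' := by
    filter_upwards [AEEqFun.coeFn_zero (α := ℝ) (β := FormalSeries d)
      (μ := volume.restrict (Icc 0 T))] with t ht
    rw [ht]
    exact (temperedSeries d).zero_mem
  add_mem' := by
    intro G H hG hH
    change ∀ᵐ t ∂_, (G + H : SeriesPath d T) t ∈ temperedSeries d
    filter_upwards [AEEqFun.coeFn_add G H, hG, hH] with t ht h1 h2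
    rw [ht]
    exact (temperedSeries d).add_mem h1 h2
  smul_mem' := by
    intro a G hG
    change ∀ᵐ t ∂_, (a • G : SeriesPath d T) t ∈ temperedSeries d
    filter_upwards [AEEqFun.coeFn_smul a G, hG] with t ht h1
    rw [ht]
    exact (temperedSeries d).smul_mem a h1

/-- `L¹([0,T]; 𝒮'(ℝ^d_+))`, the union over `N > 0` of `L¹([0,T]; 𝒮'_N)`, where
`𝒮'_N = {u ∈ 𝒮' : sup |a_n(u)| ⟨n⟩^{-N} < ∞}`. -/
abbrev L1Tempered (d : ℕ) (T : ℝ) : Type :=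
  IndLimit fun N => (pathNorm d T (polyWeight d N)).restrict (temperedPaths d T)

/-- `L¹([0,T]; 𝒢'_{0,α}(ℝ^d_+))`, the union over `h > 0` of `L¹([0,T]; 𝒢'_{α,h})`, where
`𝒢'_{α,h} = {∑ a_n l_n : sup |a_n| e^{-h|n|^{1/α}} < ∞}` (recall that the dual `𝒢'_{0,α}` of the
intersection `𝒢_{0,α}` is the union of the spaces `𝒢'_{α,h}`). -/
abbrev L1DualBeurling (d : ℕ) (T α : ℝ) : Type :=
  IndLimit fun h => pathNorm d T (decayWeight d α h)

/-- `L¹([0,T]; 𝒢'_α(ℝ^d_+))`, the intersection over `h > 0` of `L¹([0,T]; 𝒢'_{α,h})` (the dual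
`𝒢'_α` of the union `𝒢_α` is the intersection of the spaces `𝒢'_{α,h}`). -/
abbrev L1DualRoumieu (d : ℕ) (T α : ℝ) : Type :=
  ProjLimit fun h => pathNorm d T (decayWeight d α h)

/-! ## The propagator and the Cauchy problem -/

/-- The eigenvalues `ρ (|n| + c/ρ)^r` (principal branch) of the operator `ρ (E + c/ρ)^r`. -/
def scaledPowerSymbol (d : ℕ) (r : ℝ) (ρ c : ℂ) (n : MultiIndex d) : ℂ :=
  ρ * ((len n : ℂ) + c / ρ) ^ (r : ℂ)

/-- The eigenvalues `(ρ |n| + c)^r` (principal branch) of the operator `(ρ E + c)^r`. -/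
def fullPowerSymbol (d : ℕ) (r : ℝ) (ρ c : ℂ) (n : MultiIndex d) : ℂ :=
  (ρ * (len n : ℂ) + c) ^ (r : ℂ)

/-- The path `t ↦ e^{-itA} f = ∑ e^{-it λ_n} a_n l_n` for `f = ∑ a_n l_n` and the operator `A` with
`A l_n = λ_n l_n`. -/
def propagator {d : ℕ} (T : ℝ) (lam : MultiIndex d → ℂ) (a : FormalSeries d) : SeriesPath d T :=
  AEEqFun.mk (fun (t : ℝ) n => Complex.exp (-(Complex.I * (t : ℂ) * lam n)) * a n)
    (Continuous.aestronglyMeasurable (by fun_prop))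

/-- The path `u` solves `i ∂_t u - A u = F` on `[0,T]`, `u(0) = a`, in the space of formal series,
where `A l_n = λ_n l_n`. -/
def IsSolution {d : ℕ} (T : ℝ) (lam : MultiIndex d → ℂ) (F : ℝ → FormalSeries d)
    (a : FormalSeries d) (u : SeriesPath d T) : Prop :=
  ∃ v : ℝ → FormalSeries d, u =ᵐ[volume.restrict (Icc 0 T)] v ∧ v 0 = a ∧
    ∀ n, ∀ t ∈ Icc 0 T, ∃ v' : ℂ, HasDerivWithinAt (fun s => v s n) v' (Icc 0 T) t ∧
      Complex.I * v' - lam n * v t n = F t n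

/-- The map `A`, defined on those `x ∈ X` for which `A x` lies in `Y` (embedded in `E` by `emb`),
is discontinuous from `X` to `Y`. In particular `A` does not restrict to a continuous map from
`X` to `Y`. -/
def DiscontinuousFromTo {X Y E : Type*} [TopologicalSpace X] [TopologicalSpace Y]
    (emb : Y → E) (A : X → E) : Prop :=
  ∀ Φ : {x : X // A x ∈ range emb} → Y, (∀ x, emb (Φ x) = A x) → ¬ Continuous Φ

/-- The Cauchy problem `i ∂_t u - A u = F`, `u(0) = f` is well-posed from `X` to `Y`: for all
`f ∈ X` there is a solution in `Y`, which depends continuously on `f`. (Solutions are unique since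
the equation decouples into ordinary differential equations for the coefficients.) -/
def WellPosed {X Y : Type*} [TopologicalSpace X] [TopologicalSpace Y] {d : ℕ} (T : ℝ)
    (lam : MultiIndex d → ℂ) (F : ℝ → FormalSeries d) (coeff : X → FormalSeries d)
    (emb : Y → SeriesPath d T) : Prop :=
  ∃ Φ : X → Y, Continuous Φ ∧ ∀ f, IsSolution T lam F (coeff f) (emb (Φ f))

end LaguerreOrthant

end

noncomputable section

namespace LaguerreOrthant


/-! ## One-dimensional Laguerre functions -/

/-! The propagator multiplies the coefficient of `l_n` by a factor of modulus `e^{t Im λ_n}`, and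
`Im λ_n ≥ δ|n|^r` once `|n|` is large (`exists_eventually_le_im_symbol`). So on `[T/2, T]` a single
mode of length `k` is amplified by at least `e^{Tδk^r/2}`. The test sequence is `e^{-A_k} l_n` with
`n = (k,0,…,0)`. The number `A_k` is large enough for the sequence to tend to zero in `X`, but small
against `k^r`. The path of each member stays on its own mode, so all norms are explicit.

When `Y` is an inductive limit, blow-up must be seen by one continuous seminorm on the union. The
path norm with weight `e^{-|n|^γ}` serves: it is dominated by every norm of the system
(`IndLimit.continuous_toReal`). With `A_k = k^γ` the total loss is `2k^γ`, and any `γ < r` loses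
against the gain. For `𝒮` every `γ` in `(0,r)` works; for `𝒢_{0,α}` it must also exceed `1/α`,
whence the strict inequality. For `𝒢_α` the target is a projective limit, one of its own norms
suffices, and small constants replace the gap between exponents; this reaches `α = 1/r`.

The case of `𝒮` also needs facts about Laguerre functions: orthonormality, so that `l_n` has one
nonzero coefficient, and polynomial growth in `n` of its Schwartz seminorms. Both come from the
derivative of `l_j l_k`, which telescopes in the partial sums of the `l_i`.

Ill-posedness follows because two solutions for the same `F` differ by a propagated datum: a
continuous solution map `Φ` would make `Φ(f) - Φ(0)` a continuous propagator. -/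

lemma laguerrePoly_coeff (n i : ℕ) :
    (laguerrePoly n).coeff i = (-1) ^ i * (n.choose i : ℝ) / (i.factorial : ℝ) := by
  unfold laguerrePoly
  rw [Polynomial.finsetSum_coeff]
  simp only [Polynomial.coeff_monomial]
  rw [Finset.sum_ite_eq' (Finset.range (n + 1)) i]
  split_ifs with h
  · rfl
  · rw [Nat.choose_eq_zero_of_lt (by simpa using h)]
    simp

lemma laguerrePoly_zero : laguerrePoly 0 = 1 := by
  simp [laguerrePoly]

lemma laguerrePoly_eval_zero (n : ℕ) : (laguerrePoly n).eval 0 = 1 := by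
  rw [← Polynomial.coeff_zero_eq_eval_zero, laguerrePoly_coeff]
  simp

/-- Pascal's rule, coefficient by coefficient. Summing over `n` expresses the derivative through the
lower Laguerre polynomials. -/
lemma derivative_laguerrePoly_succ (n : ℕ) :
    (laguerrePoly (n + 1)).derivative = (laguerrePoly n).derivative - laguerrePoly n := by
  ext i
  simp only [Polynomial.coeff_sub, Polynomial.coeff_derivative, laguerrePoly_coeff]
  rw [Nat.choose_succ_succ, Nat.factorial_succ]
  have h1 : (i.factorial : ℝ) ≠ 0 := by positivity
  have h2 : ((i : ℝ) + 1) ≠ 0 := by positivity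
  push_cast
  field_simp
  ring

lemma derivative_laguerrePoly (n : ℕ) :
    (laguerrePoly n).derivative = -∑ j ∈ Finset.range n, laguerrePoly j := by
  induction n with
  | zero => simp [laguerrePoly_zero]
  | succ n ih => rw [derivative_laguerrePoly_succ, ih, Finset.sum_range_succ]; ring

/-- This trades a factor `x` for neighbouring indices, at the price of coefficients linear in `n`.
At `n = 0` the truncated index `n - 1` is harmless, since its coefficient vanishes. -/
lemma X_mul_laguerrePoly (n : ℕ) :
    Polynomial.X * laguerrePoly n = Polynomial.C (-((n : ℝ) + 1)) * laguerrePoly (n + 1) +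
      Polynomial.C (2 * (n : ℝ) + 1) * laguerrePoly n +
      Polynomial.C (-(n : ℝ)) * laguerrePoly (n - 1) := by
  ext i
  simp only [Polynomial.coeff_add, Polynomial.coeff_C_mul]
  rcases i with _ | i
  · simp [laguerrePoly_coeff]; ring
  rw [Polynomial.coeff_X_mul]
  simp only [laguerrePoly_coeff]
  have h1 : (i.factorial : ℝ) ≠ 0 := by positivity
  have h2 : ((i : ℝ) + 1) ≠ 0 := by positivity
  have e1 : ((n + 1).choose (i + 1) : ℝ) = n.choose i + n.choose (i + 1) := by
    rw [Nat.choose_succ_succ]; push_cast; rfl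
  -- The subtraction on the right is real, so the range where the natural one truncates is treated
  -- apart; there the binomials vanish. The same holds for `e3`.
  have e2 : (n : ℝ) * ((n - 1).choose (i + 1) : ℝ) =
      ((n : ℝ) - i - 1) * n.choose (i + 1) := by
    rcases n with _ | n
    · simp
    · have := Nat.choose_mul_succ_eq n (i + 1)
      rcases le_or_gt (i + 1) (n + 1) with h | h
      · have h' := congrArg (Nat.cast (R := ℝ)) this
        rw [Nat.cast_mul, Nat.cast_mul, Nat.cast_sub h] at h'
        push_cast at h' ⊢
        linarith
      · simp [Nat.choose_eq_zero_of_lt h, Nat.choose_eq_zero_of_lt (show n < i + 1 by omega)]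
  have e3 : ((i : ℝ) + 1) * n.choose (i + 1) = ((n : ℝ) - i) * n.choose i := by
    have := Nat.choose_succ_right_eq n i
    rcases le_or_gt i n with h | h
    · have h' := congrArg (Nat.cast (R := ℝ)) this
      rw [Nat.cast_mul, Nat.cast_mul, Nat.cast_sub h] at h'
      push_cast at h'
      linarith
    · simp [Nat.choose_eq_zero_of_lt h, Nat.choose_eq_zero_of_lt (show n < i + 1 by omega)]
  rw [Nat.factorial_succ, e1]
  push_cast
  field_simp
  rw [pow_succ]
  have e4 : ((i : ℝ) + 1) * n.choose i = ((n : ℝ) + 1) * (n.choose i + n.choose (i + 1)) -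
      (2 * (n : ℝ) + 1) * n.choose (i + 1) + n * ((n - 1).choose (i + 1) : ℝ) := by
    linear_combination -e2 + e3
  linear_combination ((-1 : ℝ) ^ i) * e4

/-- The one-dimensional Laguerre function `L_n(x) e^{-x/2}`. -/
def laguerreFun₁ (n : ℕ) (x : ℝ) : ℝ := (laguerrePoly n).eval x * Real.exp (-x / 2)

/-- The sum of the first `n` Laguerre functions. -/
def laguerreSum (n : ℕ) (x : ℝ) : ℝ := ∑ j ∈ Finset.range n, laguerreFun₁ j x

lemma laguerreSum_succ (n : ℕ) (x : ℝ) :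
    laguerreSum (n + 1) x = laguerreSum n x + laguerreFun₁ n x := Finset.sum_range_succ _ _

/-! ### Telescoping derivatives and the pointwise bound -/

lemma hasDerivAt_polyExp (p : Polynomial ℝ) (x : ℝ) :
    HasDerivAt (fun t : ℝ => p.eval t * Real.exp (-t / 2))
      ((p.derivative - Polynomial.C (1 / 2) * p).eval x * Real.exp (-x / 2)) x := by
  have e1 : HasDerivAt (fun t : ℝ => Real.exp (-t / 2)) (Real.exp (-x / 2) * (-1 / 2)) x :=
    (((hasDerivAt_id x).neg).div_const 2).exp
  refine ((p.hasDerivAt x).mul e1).congr_deriv ?_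
  simp only [Polynomial.eval_sub, Polynomial.eval_mul, Polynomial.eval_C]
  ring

lemma hasDerivAt_laguerreFun₁ (n : ℕ) (x : ℝ) :
    HasDerivAt (laguerreFun₁ n) (-(laguerreSum n x + laguerreSum (n + 1) x) / 2) x := by
  refine (hasDerivAt_polyExp (laguerrePoly n) x).congr_deriv ?_
  rw [derivative_laguerrePoly, laguerreSum_succ]
  simp only [laguerreSum, laguerreFun₁, Polynomial.eval_sub, Polynomial.eval_mul,
    Polynomial.eval_C, Polynomial.eval_neg, Polynomial.eval_finsetSum, ← Finset.sum_mul]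
  ring

/-- Write `S_n` for `laguerreSum n`. Since `l_n = S_{n+1} - S_n` and `l_n' = -(S_n + S_{n+1})/2`,
the mixed terms of the product rule cancel. This identity gives both the uniform bound (sum over `j
= k`) and orthonormality (integrate). -/
lemma hasDerivAt_laguerreFun₁_mul (j k : ℕ) (x : ℝ) :
    HasDerivAt (fun t => laguerreFun₁ j t * laguerreFun₁ k t)
      (laguerreSum j x * laguerreSum k x - laguerreSum (j + 1) x * laguerreSum (k + 1) x) x := by
  refine ((hasDerivAt_laguerreFun₁ j x).mul (hasDerivAt_laguerreFun₁ k x)).congr_deriv ?_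
  simp only [laguerreSum_succ]
  ring

lemma laguerreFun₁_zero_right (n : ℕ) : laguerreFun₁ n 0 = 1 := by
  simp [laguerreFun₁, laguerrePoly_eval_zero]

lemma hasDerivAt_sum_laguerreFun₁_sq (n : ℕ) (x : ℝ) :
    HasDerivAt (fun t => ∑ j ∈ Finset.range n, laguerreFun₁ j t * laguerreFun₁ j t)
      (-(laguerreSum n x * laguerreSum n x)) x := by
  have h := HasDerivAt.fun_sum (u := Finset.range n) fun j _ => hasDerivAt_laguerreFun₁_mul j j x
  refine h.congr_deriv ?_
  have := Finset.sum_range_sub' (fun j => laguerreSum j x * laguerreSum j x) n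
  rw [this]
  simp [laguerreSum]

/-- The sum of the squares `l_j²`, `j ≤ n`, has derivative `-S_{n+1}² ≤ 0` and equals `n + 1` at the
origin. Hence `l_n² ≤ n + 1`, more than is needed. -/
lemma abs_laguerreFun₁_le (n : ℕ) {x : ℝ} (hx : 0 ≤ x) : |laguerreFun₁ n x| ≤ n + 1 := by
  have hanti : Antitone fun t => ∑ j ∈ Finset.range (n + 1), laguerreFun₁ j t * laguerreFun₁ j t :=
    antitone_of_hasDerivAt_nonpos (hasDerivAt_sum_laguerreFun₁_sq (n + 1))
      fun t => neg_nonpos.2 (mul_self_nonneg _)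
  have h1 := hanti hx
  simp only [laguerreFun₁_zero_right, mul_one, Finset.sum_const, Finset.card_range,
    nsmul_eq_mul] at h1
  have h2 : laguerreFun₁ n x * laguerreFun₁ n x ≤
      ∑ j ∈ Finset.range (n + 1), laguerreFun₁ j x * laguerreFun₁ j x :=
    Finset.single_le_sum (f := fun j => laguerreFun₁ j x * laguerreFun₁ j x)
      (fun j _ => mul_self_nonneg _) (Finset.self_mem_range_succ n)
  push_cast at h1
  refine abs_le_of_sq_le_sq ?_ (by positivity)
  have : (0 : ℝ) ≤ n := n.cast_nonneg
  nlinarith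

/-! ### Orthonormality -/

lemma tendsto_poly_mul_exp_neg (p : Polynomial ℝ) :
    Tendsto (fun x : ℝ => p.eval x * Real.exp (-x)) atTop (𝓝 0) := by
  simpa only [Real.exp_neg, div_eq_mul_inv] using p.tendsto_div_exp_atTop

lemma integrableOn_poly_mul_exp_neg (p : Polynomial ℝ) :
    IntegrableOn (fun x : ℝ => p.eval x * Real.exp (-x)) (Ioi 0) := by
  induction p using Polynomial.induction_on' with
  | add p q hp hq =>
    simp only [Polynomial.eval_add, add_mul]
    exact hp.add hq
  | monomial n a =>
    simp only [Polynomial.eval_monomial, mul_assoc]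
    refine Integrable.const_mul ?_ a
    have h := Real.GammaIntegral_convergent (s := (n : ℝ) + 1) (by positivity)
    refine h.congr_fun (fun x _ => ?_) measurableSet_Ioi
    simp [mul_comm]

lemma laguerreFun₁_mul_eq (j k : ℕ) (x : ℝ) : laguerreFun₁ j x * laguerreFun₁ k x =
    (laguerrePoly j * laguerrePoly k).eval x * Real.exp (-x) := by
  have : Real.exp (-x) = Real.exp (-x / 2) * Real.exp (-x / 2) := by
    rw [← Real.exp_add]; ring_nf
  rw [Polynomial.eval_mul, this, laguerreFun₁, laguerreFun₁]
  ring

lemma laguerreSum_mul_eq (j k : ℕ) (x : ℝ) : laguerreSum j x * laguerreSum k x =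
    ((∑ i ∈ Finset.range j, laguerrePoly i) * ∑ i ∈ Finset.range k, laguerrePoly i).eval x *
      Real.exp (-x) := by
  have : Real.exp (-x) = Real.exp (-x / 2) * Real.exp (-x / 2) := by
    rw [← Real.exp_add]; ring_nf
  rw [Polynomial.eval_mul, this, laguerreSum, laguerreSum]
  simp only [laguerreFun₁, Polynomial.eval_finsetSum, ← Finset.sum_mul]
  ring

lemma integrableOn_laguerreSum_mul (j k : ℕ) :
    IntegrableOn (fun x => laguerreSum j x * laguerreSum k x) (Ioi 0) := by
  simp only [laguerreSum_mul_eq]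
  exact integrableOn_poly_mul_exp_neg _

/-- Integrate the derivative of `l_j l_k` over the half-line: the product is `1` at the origin and
`0` at infinity. -/
lemma integral_laguerreSum_mul_succ (j k : ℕ) :
    ∫ x in Ioi 0, laguerreSum (j + 1) x * laguerreSum (k + 1) x =
      (∫ x in Ioi 0, laguerreSum j x * laguerreSum k x) + 1 := by
  have h := integral_Ioi_of_hasDerivAt_of_tendsto' (a := (0 : ℝ)) (m := 0)
    (fun x _ => hasDerivAt_laguerreFun₁_mul j k x)
    ((integrableOn_laguerreSum_mul j k).sub (integrableOn_laguerreSum_mul (j + 1) (k + 1)))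
    (by simp only [laguerreFun₁_mul_eq]; exact tendsto_poly_mul_exp_neg _)
  rw [integral_sub (integrableOn_laguerreSum_mul j k)
    (integrableOn_laguerreSum_mul (j + 1) (k + 1))] at h
  simp only [laguerreFun₁_zero_right] at h
  linarith

lemma integral_laguerreSum_mul (j k : ℕ) :
    ∫ x in Ioi 0, laguerreSum j x * laguerreSum k x = (min j k : ℕ) := by
  induction j generalizing k with
  | zero => simp [laguerreSum]
  | succ j ih =>
    rcases k with _ | k
    · simp [laguerreSum]
    · rw [integral_laguerreSum_mul_succ, ih, Nat.succ_min_succ]; push_cast; rfl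

/-- The product `l_j l_k` is the mixed second difference of `S_j S_k`, whose integral is `min j k`;
the mixed second difference of `min` is the Kronecker delta. -/
lemma integral_laguerreFun₁_mul (j k : ℕ) :
    ∫ x in Ioi 0, laguerreFun₁ j x * laguerreFun₁ k x = if j = k then 1 else 0 := by
  have e : ∀ x, laguerreFun₁ j x * laguerreFun₁ k x =
      (laguerreSum (j + 1) x * laguerreSum (k + 1) x - laguerreSum (j + 1) x * laguerreSum k x) -
      (laguerreSum j x * laguerreSum (k + 1) x - laguerreSum j x * laguerreSum k x) := by
    intro x; simp only [laguerreSum_succ]; ring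
  have i1 := integrableOn_laguerreSum_mul (j + 1) (k + 1)
  have i2 := integrableOn_laguerreSum_mul (j + 1) k
  have i3 := integrableOn_laguerreSum_mul j (k + 1)
  have i4 := integrableOn_laguerreSum_mul j k
  have i12 : IntegrableOn (fun x => laguerreSum (j + 1) x * laguerreSum (k + 1) x -
    laguerreSum (j + 1) x * laguerreSum k x) (Ioi 0) := i1.sub i2
  have i34 : IntegrableOn (fun x => laguerreSum j x * laguerreSum (k + 1) x -
    laguerreSum j x * laguerreSum k x) (Ioi 0) := i3.sub i4
  simp only [e]
  rw [integral_sub i12 i34, integral_sub i1 i2, integral_sub i3 i4]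
  simp only [integral_laguerreSum_mul]
  rcases lt_trichotomy j k with h | h | h
  · rw [min_eq_left (by omega), min_eq_left (by omega), min_eq_left (by omega),
      min_eq_left (by omega), if_neg (by omega)]
    simp
  · subst h
    simp
  · rw [min_eq_right (by omega), min_eq_right (by omega), min_eq_right (by omega),
      min_eq_right (by omega), if_neg (by omega)]
    simp

lemma integrableOn_laguerreFun₁ (n : ℕ) : IntegrableOn (laguerreFun₁ n) (Ioi 0) := by
  have h := (integrableOn_poly_mul_exp_neg
    ((laguerrePoly n).comp (Polynomial.C 2 * Polynomial.X)))
  -- The substitution `x = 2u` turns `e^{-x/2}` into `e^{-u}`; the endpoint is written as `1/2 * 0`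
  -- to fit the scaling rule.
  rw [← mul_zero (1 / 2 : ℝ)] at h
  have h2 := (integrableOn_Ioi_comp_mul_left_iff
    (fun x : ℝ => ((laguerrePoly n).comp (Polynomial.C 2 * Polynomial.X)).eval x * Real.exp (-x)) 0
      (show (0 : ℝ) < 1 / 2 by norm_num)).2 h
  refine h2.congr_fun (fun x _ => ?_) measurableSet_Ioi
  simp only [Polynomial.eval_comp, Polynomial.eval_mul, Polynomial.eval_C, Polynomial.eval_X,
    laguerreFun₁]
  ring_nf

/-! ### Polynomial bounds for the weighted derivatives -/

/-- The operator on polynomials that corresponds to differentiation of `p(x) e^{-x/2}`. -/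
def twistedDeriv : Polynomial ℝ →ₗ[ℝ] Polynomial ℝ :=
  Polynomial.derivative - (1 / 2 : ℝ) • LinearMap.id

lemma twistedDeriv_apply (p : Polynomial ℝ) :
    twistedDeriv p = p.derivative - Polynomial.C (1 / 2) * p := by
  simp [twistedDeriv, Polynomial.smul_eq_C_mul]

lemma twistedDeriv_laguerrePoly (n : ℕ) : twistedDeriv (laguerrePoly n) =
    -∑ j ∈ Finset.range n, laguerrePoly j - (1 / 2 : ℝ) • laguerrePoly n := by
  rw [twistedDeriv_apply, derivative_laguerrePoly, Polynomial.smul_eq_C_mul]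

/-- Each factor `x` is absorbed by the three-term recurrence. The indices rise to at most `n + 1`,
which costs `2^M`, and the coefficients add up to `4n + 2 ≤ 4(n + 1)`. -/
lemma exists_bound_pow_mul_laguerreFun₁ (b : ℕ) : ∃ (C : ℝ) (M : ℕ), 0 ≤ C ∧
    ∀ (n : ℕ) (x : ℝ), 0 < x → x ^ b * |laguerreFun₁ n x| ≤ C * ((n : ℝ) + 1) ^ M := by
  induction b with
  | zero => exact ⟨1, 1, zero_le_one, fun n x hx => by simpa using abs_laguerreFun₁_le n hx.le⟩
  | succ b ih =>
    obtain ⟨C, M, hC, h⟩ := ih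
    refine ⟨4 * 2 ^ M * C, M + 1, by positivity, fun n x hx => ?_⟩
    have key : x * laguerreFun₁ n x = -((n : ℝ) + 1) * laguerreFun₁ (n + 1) x +
        (2 * n + 1) * laguerreFun₁ n x + -n * laguerreFun₁ (n - 1) x := by
      have := congrArg (fun p : Polynomial ℝ => p.eval x) (X_mul_laguerrePoly n)
      simp only [Polynomial.eval_mul, Polynomial.eval_add, Polynomial.eval_X,
        Polynomial.eval_C] at this
      simp only [laguerreFun₁]
      linear_combination Real.exp (-x / 2) * this
    have hn : (0 : ℝ) ≤ n := n.cast_nonneg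
    have e : x ^ (b + 1) * |laguerreFun₁ n x| = x ^ b * |x * laguerreFun₁ n x| := by
      rw [abs_mul, abs_of_pos hx]; ring
    have tri : |x * laguerreFun₁ n x| ≤ ((n : ℝ) + 1) * |laguerreFun₁ (n + 1) x| +
        (2 * n + 1) * |laguerreFun₁ n x| + n * |laguerreFun₁ (n - 1) x| := by
      rw [key]
      refine (abs_add_le _ _).trans (add_le_add ((abs_add_le _ _).trans (add_le_add ?_ ?_)) ?_)
      · rw [abs_mul, abs_neg, abs_of_nonneg (by positivity)]
      · rw [abs_mul, abs_of_nonneg (by positivity)]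
      · rw [abs_mul, abs_neg, abs_of_nonneg hn]
    set B : ℝ := C * (2 ^ M * ((n : ℝ) + 1) ^ M) with hB
    have bd : ∀ m : ℕ, m ≤ n + 1 → x ^ b * |laguerreFun₁ m x| ≤ B := by
      intro m hm
      refine (h m x hx).trans (mul_le_mul_of_nonneg_left ?_ hC)
      rw [← mul_pow]
      refine pow_le_pow_left₀ (by positivity) ?_ _
      have : (m : ℝ) ≤ n + 1 := by exact_mod_cast hm
      linarith
    have b1 := bd (n + 1) le_rfl
    have b2 := bd n (by omega)
    have b3 := bd (n - 1) (by omega)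
    calc x ^ (b + 1) * |laguerreFun₁ n x|
        ≤ x ^ b * (((n : ℝ) + 1) * |laguerreFun₁ (n + 1) x| +
          (2 * n + 1) * |laguerreFun₁ n x| + n * |laguerreFun₁ (n - 1) x|) := by
          rw [e]; exact mul_le_mul_of_nonneg_left tri (by positivity)
      _ = ((n : ℝ) + 1) * (x ^ b * |laguerreFun₁ (n + 1) x|) +
          (2 * n + 1) * (x ^ b * |laguerreFun₁ n x|) +
          n * (x ^ b * |laguerreFun₁ (n - 1) x|) := by ring
      _ ≤ ((n : ℝ) + 1) * B + (2 * n + 1) * B + n * B := by gcongr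
      _ ≤ 4 * ((n : ℝ) + 1) * B := by
          have : 0 ≤ B := by positivity
          nlinarith
      _ = 4 * 2 ^ M * C * ((n : ℝ) + 1) ^ (M + 1) := by rw [hB]; ring

lemma exists_bound_pow_mul_twistedDeriv (m b : ℕ) : ∃ (C : ℝ) (M : ℕ), 0 ≤ C ∧
    ∀ (n : ℕ) (x : ℝ), 0 < x →
      x ^ b * |(twistedDeriv^[m] (laguerrePoly n)).eval x * Real.exp (-x / 2)| ≤
        C * ((n : ℝ) + 1) ^ M := by
  induction m with
  | zero => exact exists_bound_pow_mul_laguerreFun₁ b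
  | succ m ih =>
    obtain ⟨C, M, hC, h⟩ := ih
    refine ⟨C, M + 1, hC, fun n x hx => ?_⟩
    have e : twistedDeriv^[m + 1] (laguerrePoly n) =
        -∑ j ∈ Finset.range n, twistedDeriv^[m] (laguerrePoly j) -
          (1 / 2 : ℝ) • twistedDeriv^[m] (laguerrePoly n) := by
      -- The innermost derivative is expanded and the other `m` pass through by linearity. This
      -- leaves `n + 1` terms of index at most `n`, so each derivative costs one power of `n + 1`.
      rw [Function.iterate_succ_apply, twistedDeriv_laguerrePoly, ← Module.End.coe_pow, map_sub,
        map_neg, map_sum, map_smul]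
    rw [e]
    simp only [Polynomial.eval_sub, Polynomial.eval_neg, Polynomial.eval_finsetSum,
      Polynomial.eval_smul, smul_eq_mul, sub_mul, neg_mul, Finset.sum_mul]
    set g : ℕ → ℝ := fun j => (twistedDeriv^[m] (laguerrePoly j)).eval x * Real.exp (-x / 2)
    have hg : ∀ j ≤ n, x ^ b * |g j| ≤ C * ((n : ℝ) + 1) ^ M := fun j hj =>
      (h j x hx).trans (by gcongr)
    have tri : |(-∑ j ∈ Finset.range n, g j) -
        1 / 2 * (twistedDeriv^[m] (laguerrePoly n)).eval x * Real.exp (-x / 2)| ≤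
        ∑ j ∈ Finset.range n, |g j| + |g n| := by
      refine (abs_sub _ _).trans (add_le_add ?_ ?_)
      · rw [abs_neg]; exact Finset.abs_sum_le_sum_abs _ _
      · rw [mul_assoc, abs_mul, abs_of_pos (by norm_num : (0 : ℝ) < 1 / 2)]
        have : 0 ≤ |g n| := abs_nonneg _
        change 1 / 2 * |g n| ≤ |g n|
        linarith
    calc _ ≤ x ^ b * (∑ j ∈ Finset.range n, |g j| + |g n|) :=
          mul_le_mul_of_nonneg_left tri (by positivity)
      _ = ∑ j ∈ Finset.range n, x ^ b * |g j| + x ^ b * |g n| := by rw [mul_add, Finset.mul_sum]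
      _ ≤ ∑ j ∈ Finset.range n, C * ((n : ℝ) + 1) ^ M + C * ((n : ℝ) + 1) ^ M :=
          add_le_add (Finset.sum_le_sum fun j hj => hg j (Finset.mem_range.1 hj).le) (hg n le_rfl)
      _ = C * ((n : ℝ) + 1) ^ (M + 1) := by
          rw [Finset.sum_const, Finset.card_range, nsmul_eq_mul]; ring


/-! ## Laguerre functions on the orthant -/

lemma laguerreFun_eq {d : ℕ} (n : MultiIndex d) (x : Fin d → ℝ) :
    laguerreFun n x = ∏ j, laguerreFun₁ (n j) (x j) := rfl

lemma orthant_eq_pi (d : ℕ) : orthant d = Set.univ.pi fun _ => Ioi (0 : ℝ) := by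
  ext x; simp [orthant]

lemma volume_restrict_orthant (d : ℕ) : (volume : Measure (Fin d → ℝ)).restrict (orthant d) =
    Measure.pi fun _ => volume.restrict (Ioi (0 : ℝ)) := by
  rw [orthant_eq_pi, volume_pi, Measure.restrict_pi_pi]

lemma integral_laguerreFun_mul {d : ℕ} (m n : MultiIndex d) :
    ∫ x in orthant d, laguerreFun m x * laguerreFun n x = if m = n then 1 else 0 := by
  simp only [laguerreFun_eq, ← Finset.prod_mul_distrib]
  rw [volume_restrict_orthant, integral_fintype_prod_eq_prod
    (fun j x => laguerreFun₁ (m j) x * laguerreFun₁ (n j) x)]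
  simp only [integral_laguerreFun₁_mul]
  split_ifs with h
  · simp [h]
  · obtain ⟨j, hj⟩ := Function.ne_iff.1 h
    exact Finset.prod_eq_zero (Finset.mem_univ j) (if_neg hj)

lemma integrableOn_laguerreFun {d : ℕ} (n : MultiIndex d) :
    IntegrableOn (laguerreFun n) (orthant d) := by
  rw [IntegrableOn, volume_restrict_orthant]
  exact Integrable.fintype_prod (f := fun j => laguerreFun₁ (n j))
    fun j => integrableOn_laguerreFun₁ (n j)

lemma toFun_laguerre {d : ℕ} (n : MultiIndex d) {x : Fin d → ℝ} (hx : x ∈ orthant d) :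
    (laguerre n).toFun x = (laguerreFun n x : ℂ) :=
  indicator_of_mem hx fun x => (laguerreFun n x : ℂ)

lemma coeff_laguerre {d : ℕ} (n : MultiIndex d) : (laguerre n).coeff = Pi.single n 1 := by
  funext m
  have h : (laguerre n).coeff m = ∫ x in orthant d, ((laguerreFun n x * laguerreFun m x : ℝ) : ℂ) :=
    setIntegral_congr_fun (isOpen_orthant d).measurableSet fun x hx => by
      simp only [toFun_laguerre n hx, Complex.ofReal_mul]
  rw [h, integral_complex_ofReal, integral_laguerreFun_mul, Pi.single_apply]
  simp only [eq_comm (a := n)]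
  split_ifs <;> simp

lemma coeff_smul {d : ℕ} (a : ℂ) (f : Schwartz d) : (a • f).coeff = a • f.coeff := by
  funext n
  change ∫ x in orthant d, (a * f.toFun x) * (laguerreFun n x : ℂ) = a * ∫ x in orthant d, _
  simp only [mul_assoc, integral_const_mul]

/-! ### Coefficient functionals and Schwartz seminorms of `l_n` -/

lemma Schwartz.norm_le_seminorm {d : ℕ} (f : Schwartz d) {x : Fin d → ℝ} (hx : x ∈ orthant d) :
    ‖f.toFun x‖ ≤ schwartzSeminorm d (0, 0) f := by
  have h := le_ciSup (f.bddAbove 0 0) ⟨x, hx⟩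
  have e : iteratedPartial 0 f.toFun = f.toFun := by
    unfold iteratedPartial
    induction List.finRange d with
    | nil => rfl
    | cons j l ih => simp
  rw [e] at h
  simp only [monomial, Pi.zero_apply, pow_zero, Finset.prod_const_one, one_mul] at h
  refine h.trans (le_of_eq ?_)
  change _ = ⨆ x : orthant d, monomial 0 x * ‖iteratedPartial 0 f.toFun x‖
  simp [monomial, e]

lemma Schwartz.integrable_mul_laguerreFun {d : ℕ} (f : Schwartz d) (n : MultiIndex d) :
    Integrable (fun x => f.toFun x * (laguerreFun n x : ℂ)) (volume.restrict (orthant d)) := by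
  refine Integrable.bdd_mul (c := schwartzSeminorm d (0, 0) f) (integrableOn_laguerreFun n).ofReal
    (f.contDiffOn.continuousOn.aestronglyMeasurable (isOpen_orthant d).measurableSet) ?_
  filter_upwards [ae_restrict_mem (isOpen_orthant d).measurableSet] with x hx
  exact f.norm_le_seminorm hx

/-- The functional `f ↦ ∫ f l_n` on `𝒮(ℝ^d_+)`. -/
def coeffLinear {d : ℕ} (n : MultiIndex d) : Schwartz d →ₗ[ℂ] ℂ where
  toFun f := f.coeff n
  map_add' f g := by
    rw [Schwartz.coeff, Schwartz.coeff, Schwartz.coeff, ← integral_add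
      (f.integrable_mul_laguerreFun n) (g.integrable_mul_laguerreFun n)]
    refine integral_congr_ae (Eventually.of_forall fun x => ?_)
    change (f.toFun x + g.toFun x) * _ = _
    exact add_mul _ _ _
  map_smul' a f := congrFun (coeff_smul a f) n

lemma norm_coeffLinear_le {d : ℕ} (n : MultiIndex d) (f : Schwartz d) : ‖coeffLinear n f‖ ≤
    (∫ x in orthant d, ‖(laguerreFun n x : ℂ)‖) * schwartzSeminorm d (0, 0) f := by
  rw [← integral_mul_const]
  refine norm_integral_le_of_norm_le
    (((integrableOn_laguerreFun n).ofReal (𝕜 := ℂ)).norm.mul_const _) ?_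
  filter_upwards [ae_restrict_mem (isOpen_orthant d).measurableSet] with x hx
  rw [norm_mul, mul_comm]
  exact mul_le_mul_of_nonneg_left (f.norm_le_seminorm hx) (norm_nonneg _)

lemma continuous_coeffLinear {d : ℕ} (n : MultiIndex d) : Continuous (coeffLinear n) := by
  refine WithSeminorms.continuous_normedSpace_rng ℂ (schwartz_withSeminorms d) (coeffLinear n)
    ⟨{(0, 0)}, (⟨∫ x in orthant d, ‖(laguerreFun n x : ℂ)‖,
      integral_nonneg fun _ => norm_nonneg _⟩ : NNReal), fun f => ?_⟩
  rw [Finset.sup_singleton]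
  exact norm_coeffLinear_le n f

/-- By orthonormality this is the series of the distribution `f ↦ a ∫ f l_n`. It places the paths of
the test sequence in `L1Tempered`, whose norms are infinite off the tempered paths. -/
lemma single_mem_temperedSeries {d : ℕ} (n : MultiIndex d) (a : ℂ) :
    (Pi.single n a : FormalSeries d) ∈ temperedSeries d := by
  refine ⟨a • ⟨coeffLinear n, continuous_coeffLinear n⟩, ?_⟩
  funext m
  change a * (laguerre m).coeff n = _
  rw [coeff_laguerre, Pi.single_apply, Pi.single_apply]
  simp only [eq_comm (a := n)]
  split_ifs <;> simp

/-- The orders `m` are chosen before `n`; this uniformity lets the one-dimensional bounds give a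
constant and a power independent of `n`. -/
lemma iteratedPartial_laguerre {d : ℕ} (α : MultiIndex d) : ∃ m : MultiIndex d,
    ∀ n : MultiIndex d, EqOn (iteratedPartial α (laguerre n).toFun)
      (expPoly fun j => twistedDeriv^[m j] (laguerrePoly (n j))) (orthant d) := by
  unfold iteratedPartial
  induction List.finRange d with
  | nil => exact ⟨0, fun n x hx => toFun_laguerre n hx⟩
  | cons j l ih =>
    simp only [List.foldr_cons]
    induction α j with
    | zero => exact ih
    | succ k ihk =>
      obtain ⟨m, hm⟩ := ihk
      refine ⟨Function.update m j (m j + 1), fun n x hx => ?_⟩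
      rw [Function.iterate_succ_apply', partialDeriv_congr j (hm n) hx, partialDeriv_expPoly,
        ← twistedDeriv_apply, ← Function.iterate_succ_apply' twistedDeriv]
      congr 1
      funext i
      rcases eq_or_ne i j with rfl | h
      · simp
      · simp [Function.update_of_ne h]

lemma exists_bound_schwartzSeminorm_laguerre {d : ℕ} (p : MultiIndex d × MultiIndex d) :
    ∃ (C : ℝ) (M : ℕ), 0 ≤ C ∧
      ∀ n : MultiIndex d, schwartzSeminorm d p (laguerre n) ≤ C * ((len n : ℝ) + 1) ^ M := by
  obtain ⟨m, hm⟩ := iteratedPartial_laguerre p.1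
  choose C M hC h using fun j => exists_bound_pow_mul_twistedDeriv (m j) (p.2 j)
  refine ⟨∏ j, C j, ∑ j, M j, Finset.prod_nonneg fun j _ => hC j, fun n => ciSup_le fun x => ?_⟩
  rw [hm n x.2]
  have e : monomial p.2 x * ‖expPoly (fun j => twistedDeriv^[m j] (laguerrePoly (n j))) x‖ =
      ∏ j, (x : Fin d → ℝ) j ^ p.2 j *
        |(twistedDeriv^[m j] (laguerrePoly (n j))).eval ((x : Fin d → ℝ) j) *
          Real.exp (-((x : Fin d → ℝ) j) / 2)| := by
    unfold monomial expPoly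
    rw [Complex.norm_real, Real.norm_eq_abs, Finset.abs_prod, ← Finset.prod_mul_distrib]
  rw [e, ← Finset.prod_pow_eq_pow_sum, ← Finset.prod_mul_distrib]
  refine Finset.prod_le_prod (fun j _ => mul_nonneg (pow_nonneg (x.2 j).le _) (abs_nonneg _))
    fun j _ => (h j (n j) _ (x.2 j)).trans ?_
  refine mul_le_mul_of_nonneg_left (pow_le_pow_left₀ (by positivity) ?_ _) (hC j)
  have : n j ≤ len n := Finset.single_le_sum (f := n) (fun _ _ => Nat.zero_le _) (Finset.mem_univ j)
  have : (n j : ℝ) ≤ len n := by exact_mod_cast this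
  linarith


/-! ## Inductive and projective limits -/

section Limits

variable {E : Type*} [AddCommGroup E] [Module ℂ E] (q : Ioi (0 : ℝ) → ExtSeminorm E)

lemma ProjLimit.withSeminorms : WithSeminorms (projSeminorm q) := ⟨rfl⟩

lemma IndLimit.withSeminorms : WithSeminorms (indSeminorm q) := ⟨rfl⟩

instance : IsTopologicalAddGroup (ProjLimit q) := (ProjLimit.withSeminorms q).topologicalAddGroup

instance : IsTopologicalAddGroup (IndLimit q) := (IndLimit.withSeminorms q).topologicalAddGroup

lemma ProjLimit.emb_injective : Function.Injective (ProjLimit.emb q) := Subtype.val_injective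

lemma IndLimit.emb_injective : Function.Injective (IndLimit.emb q) := Subtype.val_injective

lemma ProjLimit.emb_sub (x y : ProjLimit q) : (x - y).emb q = x.emb q - y.emb q := rfl

lemma IndLimit.emb_sub (x y : IndLimit q) : (x - y).emb q = x.emb q - y.emb q := rfl

lemma ExtSeminorm.toFun_lt_top_of_mem_iSup {P : ExtSeminorm E}
    (h : ∀ i, ∃ C : NNReal, ∀ x, P.toFun x ≤ C * (q i).toFun x) (x : IndLimit q) :
    P.toFun (x.emb q) < ⊤ := by
  have hle : (⨆ i, (q i).finite : Submodule ℂ E) ≤ P.finite := iSup_le fun i y hy => by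
    obtain ⟨C, hC⟩ := h i
    exact (hC y).trans_lt (ENNReal.mul_lt_top ENNReal.coe_lt_top hy)
  exact hle x.2

/-- An extended seminorm that is dominated by all the norms of an inductive system gives a
continuous function on the inductive limit. -/
lemma IndLimit.continuous_toReal {P : ExtSeminorm E}
    (h : ∀ i, ∃ C : NNReal, ∀ x, P.toFun x ≤ C * (q i).toFun x) :
    Continuous fun x : IndLimit q => (P.toFun (x.emb q)).toReal := by
  have fin := ExtSeminorm.toFun_lt_top_of_mem_iSup q h
  let p : Seminorm ℂ (IndLimit q) := Seminorm.ofSMulLE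
    (fun x => (P.toFun (x.emb q)).toReal)
    (by change (P.toFun 0).toReal = 0; simp [P.map_zero])
    (by
      intro x y
      rw [← ENNReal.toReal_add (fin x).ne (fin y).ne]
      exact ENNReal.toReal_mono (ENNReal.add_lt_top.2 ⟨fin x, fin y⟩).ne (P.map_add_le _ _))
    (by
      intro a x
      rw [← toReal_enorm a, ← ENNReal.toReal_mul]
      exact ENNReal.toReal_mono (ENNReal.mul_lt_top enorm_lt_top (fin x)).ne (P.map_smul_le _ _))
  have hp : ∀ i, ∃ C : ℝ, ∀ x : IndLimit q, (q i).toFun (x.emb q) < ⊤ →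
      p x ≤ C * ((q i).toFun (x.emb q)).toReal := by
    intro i
    obtain ⟨C, hC⟩ := h i
    refine ⟨C, fun x hx => ?_⟩
    change (P.toFun (x.emb q)).toReal ≤ _
    rw [← ENNReal.coe_toReal, ← ENNReal.toReal_mul]
    exact ENNReal.toReal_mono (ENNReal.mul_lt_top ENNReal.coe_lt_top hx).ne (hC _)
  exact (IndLimit.withSeminorms q).continuous_seminorm ⟨p, hp⟩

lemma ProjLimit.continuous_toReal (h : Ioi (0 : ℝ)) :
    Continuous fun x : ProjLimit q => ((q h).toFun (x.emb q)).toReal :=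
  (ProjLimit.withSeminorms q).continuous_seminorm h

/-- The element of the union given by a vector of finite norm. -/
def IndLimit.mk {x : E} (h : Ioi (0 : ℝ)) (hx : (q h).toFun x < ⊤) : IndLimit q :=
  ⟨x, Submodule.mem_iSup_of_mem h hx⟩

/-- The element of the intersection given by a vector all of whose norms are finite. -/
def ProjLimit.mk {x : E} (hx : ∀ h, (q h).toFun x < ⊤) : ProjLimit q :=
  ⟨x, (Submodule.mem_iInf _).2 hx⟩

@[simp] lemma IndLimit.emb_mk {x : E} (h : Ioi (0 : ℝ)) (hx : (q h).toFun x < ⊤) :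
    (IndLimit.mk q h hx).emb q = x := rfl

@[simp] lemma ProjLimit.emb_mk {x : E} (hx : ∀ h, (q h).toFun x < ⊤) :
    (ProjLimit.mk q hx).emb q = x := rfl

lemma ProjLimit.tendsto_zero {ι : Type*} {l : Filter ι} {x : ι → ProjLimit q}
    (hx : ∀ h, Tendsto (fun i => ((q h).toFun ((x i).emb q)).toReal) l (𝓝 0)) :
    Tendsto x l (𝓝 0) := by
  refine ((ProjLimit.withSeminorms q).tendsto_nhds x 0).2 fun h ε hε => ?_
  filter_upwards [(hx h).eventually (gt_mem_nhds hε)] with i hi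
  rwa [sub_zero]

/-- A sequence in one of the normed spaces that converges there converges in the union. -/
lemma IndLimit.tendsto_zero {ι : Type*} {l : Filter ι} {x : ι → IndLimit q} (h : Ioi (0 : ℝ))
    (fin : ∀ i, (q h).toFun ((x i).emb q) < ⊤)
    (hx : Tendsto (fun i => ((q h).toFun ((x i).emb q)).toReal) l (𝓝 0)) :
    Tendsto x l (𝓝 0) := by
  refine ((IndLimit.withSeminorms q).tendsto_nhds x 0).2 fun p ε hε => ?_
  obtain ⟨C, hC⟩ := p.2 h
  have h0 := hx.const_mul C
  rw [mul_zero] at h0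
  filter_upwards [h0.eventually (gt_mem_nhds hε)] with i hi
  rw [sub_zero]
  exact (hC (x i) (fin i)).trans_lt hi

end Limits

lemma Schwartz.tendsto_zero {ι : Type*} {l : Filter ι} {d : ℕ} {x : ι → Schwartz d}
    (hx : ∀ p, Tendsto (fun i => schwartzSeminorm d p (x i)) l (𝓝 0)) : Tendsto x l (𝓝 0) := by
  refine ((schwartz_withSeminorms d).tendsto_nhds x 0).2 fun p ε hε => ?_
  filter_upwards [(hx p).eventually (gt_mem_nhds hε)] with i hi
  rwa [sub_zero]

/-! ## Discontinuity and ill-posedness -/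

/-- Injectivity of `emb` forces `Φ (x k) = y k`, so continuity at `0` would make `P (y k)` converge.
The point `y₀` only shows that `0` lies in the domain. -/
lemma discontinuousFromTo_of_tendsto {X Y E : Type*} [TopologicalSpace X] [Zero X]
    [TopologicalSpace Y] {emb : Y → E} {A : X → E} (inj : Function.Injective emb) {x : ℕ → X}
    (hx : Tendsto x atTop (𝓝 0)) {y : ℕ → Y} (hy : ∀ k, emb (y k) = A (x k)) {y₀ : Y}
    (hy₀ : emb y₀ = A 0) {P : Y → ℝ} (hP : Continuous P)
    (hlim : Tendsto (fun k => P (y k)) atTop atTop) : DiscontinuousFromTo emb A := by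
  intro Φ hΦ hc
  let z : ℕ → {x : X // A x ∈ range emb} := fun k => ⟨x k, y k, hy k⟩
  let z₀ : {x : X // A x ∈ range emb} := ⟨0, y₀, hy₀⟩
  have hz : Tendsto z atTop (𝓝 z₀) := tendsto_subtype_rng.2 hx
  have h1 : Tendsto (fun k => P (Φ (z k))) atTop (𝓝 (P (Φ z₀))) :=
    ((hP.comp hc).tendsto z₀).comp hz
  have h2 : ∀ k, Φ (z k) = y k := fun k => inj ((hΦ (z k)).trans (hy k).symm)
  simp only [h2] at h1
  exact not_tendsto_nhds_of_tendsto_atTop hlim _ h1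

/-- The difference of two solutions for the same right-hand side is given by the propagator. -/
lemma IsSolution.sub_eq_propagator {d : ℕ} {T : ℝ} (hT : 0 < T) {lam : MultiIndex d → ℂ}
    {F : ℝ → FormalSeries d} {a b : FormalSeries d} {u w : SeriesPath d T}
    (hu : IsSolution T lam F a u) (hw : IsSolution T lam F b w) :
    u - w = propagator T lam (a - b) := by
  obtain ⟨v₁, hv₁, h01, hs₁⟩ := hu
  obtain ⟨v₂, hv₂, h02, hs₂⟩ := hw
  have key : ∀ n, ∀ t ∈ Icc 0 T, v₁ t n - v₂ t n =
      Complex.exp (-(Complex.I * (t : ℂ) * lam n)) * (a - b) n := by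
    intro n t ht
    -- Integrating factor: `F` cancels in the difference, so `z` has zero derivative on `[0,T]` and
    -- keeps its initial value.
    set z : ℝ → ℂ := fun s => Complex.exp (Complex.I * (s : ℂ) * lam n) * (v₁ s n - v₂ s n) with hz
    have hd : ∀ s ∈ Icc 0 T, HasDerivWithinAt z 0 (Icc 0 T) s := by
      intro s hs
      obtain ⟨d₁, hd₁, e₁⟩ := hs₁ n s hs
      obtain ⟨d₂, hd₂, e₂⟩ := hs₂ n s hs
      have hE : HasDerivAt (fun s : ℝ => Complex.exp (Complex.I * (s : ℂ) * lam n))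
          (Complex.exp (Complex.I * (s : ℂ) * lam n) * (Complex.I * 1 * lam n)) s :=
        (((hasDerivAt_id s).ofReal_comp.const_mul Complex.I).mul_const (lam n)).cexp
      refine (hE.hasDerivWithinAt.mul (hd₁.sub hd₂)).congr_deriv ?_
      have e : d₁ - d₂ = -(Complex.I * lam n * (v₁ s n - v₂ s n)) := by
        linear_combination (-Complex.I) * e₁ + Complex.I * e₂ + (d₁ - d₂) * Complex.I_mul_I
      simp only [Pi.sub_apply]
      rw [e]
      ring
    have hconst := constant_of_derivWithin_zero (f := z) (a := 0) (b := T)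
      (fun s hs => (hd s hs).differentiableWithinAt)
      (fun s hs => (hd s (Ico_subset_Icc_self hs)).derivWithin
        (uniqueDiffOn_Icc hT s (Ico_subset_Icc_self hs))) t ht
    simp only [hz, Complex.ofReal_zero, mul_zero, zero_mul, Complex.exp_zero, one_mul, h01,
      h02] at hconst
    rw [Pi.sub_apply, ← hconst, ← mul_assoc, ← Complex.exp_add, neg_add_cancel, Complex.exp_zero,
      one_mul]
  refine AEEqFun.ext ?_
  filter_upwards [AEEqFun.coeFn_sub u w, hv₁, hv₂, ae_restrict_mem measurableSet_Icc,
    AEEqFun.coeFn_mk (μ := volume.restrict (Icc 0 T))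
      (fun (t : ℝ) n => Complex.exp (-(Complex.I * (t : ℂ) * lam n)) * (a - b) n)
      (Continuous.aestronglyMeasurable (by fun_prop))] with t h1 h2 h3 h4 h5
  rw [h1, propagator, h5]
  funext n
  simp only [Pi.sub_apply, h2, h3]
  exact key n t h4

/-- Subtracting the solution with zero datum removes `F`: `Φ x - Φ 0` is the propagated datum and
still depends continuously on `x`. -/
lemma not_wellPosed_of_discontinuous {X Y : Type*} [TopologicalSpace X] [Zero X]
    [TopologicalSpace Y] [AddCommGroup Y] [IsTopologicalAddGroup Y] {d : ℕ} {T : ℝ} (hT : 0 < T)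
    {lam : MultiIndex d → ℂ} {coeff : X → FormalSeries d} (hcoeff : coeff 0 = 0)
    {emb : Y → SeriesPath d T} (hemb : ∀ x y, emb (x - y) = emb x - emb y)
    (h : DiscontinuousFromTo emb fun f => propagator T lam (coeff f)) (F : ℝ → FormalSeries d) :
    ¬ WellPosed T lam F coeff emb := by
  rintro ⟨Φ, hc, hs⟩
  refine h (fun x => Φ x - Φ 0) (fun x => ?_)
    ((hc.comp continuous_subtype_val).sub continuous_const)
  rw [hemb, (hs x).sub_eq_propagator hT (hs 0), hcoeff, sub_zero]


/-! ## Growth of the symbols -/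

/-- A positive factor leaves the argument unchanged, so the principal branch does not jump. -/
lemma ofReal_mul_cpow {x : ℝ} (hx : 0 < x) {z : ℂ} (hz : z ≠ 0) (s : ℂ) :
    ((x : ℂ) * z) ^ s = (x : ℂ) ^ s * z ^ s := by
  have hx' : (x : ℂ) ≠ 0 := Complex.ofReal_ne_zero.2 hx.ne'
  rw [Complex.cpow_def_of_ne_zero (mul_ne_zero hx' hz), Complex.cpow_def_of_ne_zero hx',
    Complex.cpow_def_of_ne_zero hz, Complex.log_ofReal_mul hx hz, ← Complex.ofReal_log hx.le,
    add_mul, Complex.exp_add]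

/-- Pull `k` out of `ak + b`; then `(a + b/k)^r → a^r`, the power being continuous off the cut. -/
lemma tendsto_affine_cpow_div {a : ℂ} (ha : a ∈ Complex.slitPlane) (b : ℂ) (r : ℝ) :
    Tendsto (fun k : ℕ => (a * (k : ℂ) + b) ^ (r : ℂ) / (((k : ℝ) ^ r : ℝ) : ℂ)) atTop
      (𝓝 (a ^ (r : ℂ))) := by
  have h1 : Tendsto (fun k : ℕ => a + b / (k : ℂ)) atTop (𝓝 a) := by
    simpa using (tendsto_const_div_atTop_nhds_zero_nat b).const_add a
  have h2 : Tendsto (fun k : ℕ => (a + b / (k : ℂ)) ^ (r : ℂ)) atTop (𝓝 (a ^ (r : ℂ))) :=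
    ((continuousAt_id.cpow continuousAt_const ha).tendsto).comp h1
  refine h2.congr' ?_
  filter_upwards [eventually_gt_atTop 0, h1.eventually_ne (Complex.slitPlane_ne_zero ha)]
    with k hk hne
  have hk' : (0 : ℝ) < k := by exact_mod_cast hk
  have hk0 : (k : ℂ) ≠ 0 := by exact_mod_cast hk.ne'
  have e : a * (k : ℂ) + b = ((k : ℝ) : ℂ) * (a + b / (k : ℂ)) := by
    push_cast
    field_simp
  have hp : (((k : ℝ) ^ r : ℝ) : ℂ) ≠ 0 := by
    exact_mod_cast (Real.rpow_pos_of_pos hk' r).ne'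
  rw [e, ofReal_mul_cpow hk' hne, ← Complex.ofReal_cpow hk'.le, mul_div_cancel_left₀ _ hp]

lemma eventually_le_im_of_tendsto {g : ℕ → ℂ} {r : ℝ} {L : ℂ} (hL : 0 < L.im)
    (h : Tendsto (fun k : ℕ => g k / (((k : ℝ) ^ r : ℝ) : ℂ)) atTop (𝓝 L)) :
    ∃ δ : ℝ, 0 < δ ∧ ∀ᶠ k : ℕ in atTop, δ * (k : ℝ) ^ r ≤ (g k).im := by
  refine ⟨L.im / 2, half_pos hL, ?_⟩
  have h1 := ((Complex.continuous_im.tendsto L).comp h).eventually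
    (lt_mem_nhds (half_lt_self hL))
  filter_upwards [h1, eventually_gt_atTop 0] with k hk hk0
  have hp : 0 < (k : ℝ) ^ r := Real.rpow_pos_of_pos (by exact_mod_cast hk0) r
  simp only [Function.comp, Complex.div_ofReal_im] at hk
  exact ((lt_div_iff₀ hp).1 hk).le

/-- Divided by `k^r`, the two symbols tend to `ρ` and to `ρ^r`, whose imaginary parts are positive.
They depend on `n` only through its length, so the bound is uniform over all `n` of length `k`. -/
lemma exists_eventually_le_im_symbol {d : ℕ} {r : ℝ} {ρ c : ℂ} (hρ : 0 < ρ.im)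
    {lam : MultiIndex d → ℂ} (hlam : lam = scaledPowerSymbol d r ρ c ∨
      (0 < (ρ ^ (r : ℂ)).im ∧ lam = fullPowerSymbol d r ρ c)) :
    ∃ δ : ℝ, 0 < δ ∧ ∀ᶠ k : ℕ in atTop, ∀ n : MultiIndex d, len n = k →
      δ * (k : ℝ) ^ r ≤ (lam n).im := by
  rcases hlam with rfl | ⟨h, rfl⟩
  · have h1 := (tendsto_affine_cpow_div Complex.one_mem_slitPlane (c / ρ) r).const_mul ρ
    rw [Complex.one_cpow, mul_one] at h1
    simp only [one_mul, ← mul_div_assoc] at h1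
    obtain ⟨δ, hδ, h2⟩ := eventually_le_im_of_tendsto hρ h1
    refine ⟨δ, hδ, h2.mono ?_⟩
    rintro k hk n rfl
    exact hk
  · obtain ⟨δ, hδ, h2⟩ := eventually_le_im_of_tendsto h
      (tendsto_affine_cpow_div (a := ρ) (Or.inr hρ.ne') c r)
    refine ⟨δ, hδ, h2.mono ?_⟩
    rintro k hk n rfl
    exact hk

/-! ## Comparison of growth rates -/

lemma tendsto_natCast_rpow_atTop {γ : ℝ} (hγ : 0 < γ) :
    Tendsto (fun k : ℕ => (k : ℝ) ^ γ) atTop atTop :=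
  (tendsto_rpow_atTop hγ).comp tendsto_natCast_atTop_atTop

lemma tendsto_sub_atTop_of_isLittleO {u v : ℕ → ℝ} (hv : Tendsto v atTop atTop)
    (h : u =o[atTop] v) : Tendsto (fun k => v k - u k) atTop atTop := by
  refine tendsto_atTop_mono' atTop ?_ (hv.atTop_mul_const (half_pos one_pos))
  filter_upwards [h.bound (half_pos one_pos), hv.eventually_ge_atTop 0] with k hk h0
  rw [Real.norm_eq_abs, Real.norm_eq_abs, abs_of_nonneg h0] at hk
  linarith [le_abs_self (u k)]

lemma isLittleO_natCast_rpow {a γ : ℝ} (h : a < γ) :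
    (fun k : ℕ => (k : ℝ) ^ a) =o[atTop] fun k : ℕ => (k : ℝ) ^ γ := by
  have h1 : Tendsto (fun k : ℕ => (k : ℝ) ^ (-(γ - a))) atTop (𝓝 0) :=
    (tendsto_rpow_neg_atTop (sub_pos.2 h)).comp tendsto_natCast_atTop_atTop
  refine (Asymptotics.isLittleO_iff_tendsto' ?_).2 (h1.congr' ?_)
  · filter_upwards [eventually_gt_atTop 0] with k hk h0
    exact absurd h0 (Real.rpow_pos_of_pos (by exact_mod_cast hk) γ).ne'
  · filter_upwards [eventually_gt_atTop 0] with k hk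
    rw [← Real.rpow_sub (by exact_mod_cast hk), neg_sub]

lemma isLittleO_log_natCast_add_one {γ : ℝ} (hγ : 0 < γ) :
    (fun k : ℕ => Real.log ((k : ℝ) + 1)) =o[atTop] fun k : ℕ => (k : ℝ) ^ γ := by
  have h1 : (fun k : ℕ => Real.log ((k : ℝ) + 1)) =o[atTop] fun k : ℕ => ((k : ℝ) + 1) ^ γ :=
    (isLittleO_log_rpow_atTop hγ).comp_tendsto
      (tendsto_natCast_atTop_atTop.atTop_add tendsto_const_nhds)
  refine h1.trans_isBigO (Asymptotics.IsBigO.of_bound (2 ^ γ) ?_)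
  filter_upwards [eventually_ge_atTop 1] with k hk
  have hk' : (1 : ℝ) ≤ k := by exact_mod_cast hk
  rw [Real.norm_of_nonneg (by positivity), Real.norm_of_nonneg (by positivity),
    ← Real.mul_rpow (by norm_num) (by positivity)]
  exact Real.rpow_le_rpow (by positivity) (by linarith) hγ.le

lemma tendsto_exp_sub_nhds_zero {u v : ℕ → ℝ} (hv : Tendsto v atTop atTop)
    (h : u =o[atTop] v) : Tendsto (fun k => Real.exp (u k - v k)) atTop (𝓝 0) := by
  refine Real.tendsto_exp_atBot.comp ?_
  simpa [Function.comp_def] using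
    tendsto_neg_atTop_atBot.comp (tendsto_sub_atTop_of_isLittleO hv h)

/-- The ratio converges, hence is bounded over all `k`; comparing norms needs the inequality at
every index, not just eventually. -/
lemma exists_exp_neg_le {u v : ℕ → ℝ} (hv : Tendsto v atTop atTop) (h : u =o[atTop] v) :
    ∃ C : ℝ, ∀ k, Real.exp (-v k) ≤ C * Real.exp (-u k) := by
  obtain ⟨C, hC⟩ := (tendsto_exp_sub_nhds_zero hv h).bddAbove_range
  refine ⟨C, fun k => ?_⟩
  have e : Real.exp (-v k) = Real.exp (u k - v k) * Real.exp (-u k) := by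
    rw [← Real.exp_add]; ring_nf
  rw [e]
  exact mul_le_mul_of_nonneg_right (hC ⟨k, rfl⟩) (Real.exp_pos _).le

lemma decayWeight_one_div (d : ℕ) (γ : ℝ) (h : Ioi (0 : ℝ)) (n : MultiIndex d) :
    decayWeight d (1 / γ) h n = Real.exp (-(h * (len n : ℝ) ^ γ)) := by
  rw [decayWeight, one_div_one_div]

/-- One weight `e^{-|n|^γ}` lies below all polynomial ones, so its path norm is continuous on the
inductive limit. -/
lemma exists_decayWeight_le_polyWeight (d : ℕ) {γ : ℝ} (hγ : 0 < γ) (N : Ioi (0 : ℝ)) :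
    ∃ C : ℝ, ∀ n, decayWeight d (1 / γ) ⟨1, mem_Ioi.2 one_pos⟩ n ≤ C * polyWeight d N n := by
  obtain ⟨C, hC⟩ := exists_exp_neg_le (tendsto_natCast_rpow_atTop hγ)
    ((isLittleO_log_natCast_add_one hγ).const_mul_left (N : ℝ))
  have hC0 : 0 ≤ C := by
    by_contra hneg
    exact absurd (hC 0) (not_le.2 ((mul_neg_of_neg_of_pos (not_le.1 hneg) (Real.exp_pos _)).trans
      (Real.exp_pos _)))
  refine ⟨C, fun n => ?_⟩
  rw [decayWeight_one_div, one_mul]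
  refine (hC (len n)).trans (mul_le_mul_of_nonneg_left ?_ hC0)
  have hk : (0 : ℝ) ≤ len n := Nat.cast_nonneg _
  have hs : 0 < Real.sqrt (1 + (len n : ℝ) ^ 2) := Real.sqrt_pos.2 (by positivity)
  have e : Real.exp (-((N : ℝ) * Real.log ((len n : ℝ) + 1))) =
      ((len n : ℝ) + 1) ^ (-(N : ℝ)) := by
    rw [Real.rpow_def_of_pos (by positivity)]; ring_nf
  rw [e, polyWeight]
  -- The exponent is negative, so `√(1 + k²) ≤ k + 1` is the inequality required.
  refine Real.rpow_le_rpow_of_nonpos hs ?_ (neg_nonpos.2 (le_of_lt N.2))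
  exact Real.sqrt_le_iff.2 ⟨by positivity, by nlinarith⟩

lemma exists_decayWeight_le_decayWeight (d : ℕ) {α γ : ℝ} (hα : 1 / α < γ) (hγ : 0 < γ)
    (h : Ioi (0 : ℝ)) :
    ∃ C : ℝ, ∀ n, decayWeight d (1 / γ) ⟨1, mem_Ioi.2 one_pos⟩ n ≤ C * decayWeight d α h n := by
  obtain ⟨C, hC⟩ := exists_exp_neg_le (tendsto_natCast_rpow_atTop hγ)
    ((isLittleO_natCast_rpow hα).const_mul_left (h : ℝ))
  refine ⟨C, fun n => ?_⟩
  rw [decayWeight_one_div, one_mul]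
  exact hC (len n)

/-! ## Norms of series and paths -/

lemma seriesNorm_le {d : ℕ} {w w' : MultiIndex d → ℝ} {C : ℝ} (hw' : ∀ n, 0 ≤ w' n)
    (h : ∀ n, w n ≤ C * w' n) (a : FormalSeries d) :
    (seriesNorm w).toFun a ≤ C.toNNReal * (seriesNorm w').toFun a := by
  refine iSup_le fun n => ?_
  have h1 : ENNReal.ofReal (w n) ≤ C.toNNReal * ENNReal.ofReal (w' n) :=
    (ENNReal.ofReal_le_ofReal (h n)).trans_eq (ENNReal.ofReal_mul' (hw' n))
  calc ‖a n‖ₑ * ENNReal.ofReal (w n)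
      ≤ ‖a n‖ₑ * (C.toNNReal * ENNReal.ofReal (w' n)) := mul_le_mul_right h1 _
    _ = C.toNNReal * (‖a n‖ₑ * ENNReal.ofReal (w' n)) := mul_left_comm _ _ _
    _ ≤ _ := mul_le_mul_right (le_iSup (fun n => ‖a n‖ₑ * ENNReal.ofReal (w' n)) n) _

lemma pathNorm_le {d : ℕ} {T : ℝ} {w w' : MultiIndex d → ℝ} {C : ℝ} (hw' : ∀ n, 0 ≤ w' n)
    (h : ∀ n, w n ≤ C * w' n) (G : SeriesPath d T) :
    (pathNorm d T w).toFun G ≤ C.toNNReal * (pathNorm d T w').toFun G := by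
  change ∫⁻ t in Icc 0 T, _ ≤ _ * ∫⁻ t in Icc 0 T, _
  rw [← lintegral_const_mul' _ _ ENNReal.coe_ne_top]
  exact lintegral_mono fun t => seriesNorm_le hw' h _

lemma seriesNorm_single {d : ℕ} (w : MultiIndex d → ℝ) (n : MultiIndex d) (a : ℂ) :
    (seriesNorm w).toFun (Pi.single n a) = ‖a‖ₑ * ENNReal.ofReal (w n) := by
  refine le_antisymm (iSup_le fun m => ?_) ?_
  · rcases eq_or_ne m n with rfl | h
    · simp
    · simp [h]
  · refine le_trans (by simp)
      (le_iSup (fun m => ‖(Pi.single n a : FormalSeries d) m‖ₑ * ENNReal.ofReal (w m)) n)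

lemma coeFn_propagator_single {d : ℕ} (T : ℝ) (lam : MultiIndex d → ℂ) (n : MultiIndex d) (a : ℂ) :
    ∀ᵐ t ∂(volume.restrict (Icc 0 T)), propagator T lam (Pi.single n a) t =
      Pi.single n (Complex.exp (-(Complex.I * (t : ℂ) * lam n)) * a) := by
  filter_upwards [AEEqFun.coeFn_mk (μ := volume.restrict (Icc 0 T))
    (fun (t : ℝ) m => Complex.exp (-(Complex.I * (t : ℂ) * lam m)) *
      (Pi.single n a : FormalSeries d) m)
    (Continuous.aestronglyMeasurable (by fun_prop))] with t ht
  rw [propagator, ht]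
  funext m
  rcases eq_or_ne m n with rfl | h
  · simp
  · simp [h]

lemma norm_exp_neg_I_mul (t : ℝ) (z : ℂ) :
    ‖Complex.exp (-(Complex.I * (t : ℂ) * z))‖ = Real.exp (t * z.im) := by
  rw [Complex.norm_exp]
  congr 1
  simp [mul_assoc]

lemma pathNorm_propagator_single {d : ℕ} (T : ℝ) (lam : MultiIndex d → ℂ) (w : MultiIndex d → ℝ)
    (n : MultiIndex d) (a : ℂ) :
    (pathNorm d T w).toFun (propagator T lam (Pi.single n a)) =
      ∫⁻ t in Icc 0 T, ENNReal.ofReal (Real.exp (t * (lam n).im)) *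
        (‖a‖ₑ * ENNReal.ofReal (w n)) := by
  refine lintegral_congr_ae ?_
  filter_upwards [coeFn_propagator_single T lam n a] with t ht
  rw [ht, seriesNorm_single, enorm_mul, ← ofReal_norm (Complex.exp _),
    norm_exp_neg_I_mul, mul_assoc]

lemma pathNorm_propagator_single_lt_top {d : ℕ} (T : ℝ) (lam : MultiIndex d → ℂ)
    (w : MultiIndex d → ℝ) (n : MultiIndex d) (a : ℂ) :
    (pathNorm d T w).toFun (propagator T lam (Pi.single n a)) < ⊤ := by
  rw [pathNorm_propagator_single]
  have hc : ‖a‖ₑ * ENNReal.ofReal (w n) < ⊤ := ENNReal.mul_lt_top enorm_lt_top ENNReal.ofReal_lt_top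
  rw [lintegral_mul_const' _ _ hc.ne]
  refine ENNReal.mul_lt_top ?_ hc
  have hi : IntegrableOn (fun t : ℝ => Real.exp (t * (lam n).im)) (Icc 0 T) :=
    Continuous.integrableOn_Icc (by fun_prop)
  exact hi.lintegral_lt_top

/-- Keep only the times in `[T/2, T]`: an interval of length `T/2` on which the growth factor is at
least its value at `T/2`. -/
lemma le_pathNorm_propagator_single {d : ℕ} {T : ℝ} (hT : 0 < T) {lam : MultiIndex d → ℂ}
    (w : MultiIndex d → ℝ) {n : MultiIndex d} (hn : 0 ≤ (lam n).im) (a : ℂ) :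
    T / 2 * Real.exp (T / 2 * (lam n).im) * (‖a‖ * w n) ≤
      ((pathNorm d T w).toFun (propagator T lam (Pi.single n a))).toReal := by
  rw [← ENNReal.ofReal_le_iff_le_toReal (pathNorm_propagator_single_lt_top T lam w n a).ne,
    pathNorm_propagator_single]
  calc ENNReal.ofReal (T / 2 * Real.exp (T / 2 * (lam n).im) * (‖a‖ * w n))
      = ∫⁻ t in Icc (T / 2) T, ENNReal.ofReal (Real.exp (T / 2 * (lam n).im)) *
        (‖a‖ₑ * ENNReal.ofReal (w n)) := by
        rw [setLIntegral_const, Real.volume_Icc, sub_half, ← ofReal_norm,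
          ← ENNReal.ofReal_mul (norm_nonneg _), ← ENNReal.ofReal_mul (Real.exp_pos _).le,
          ← ENNReal.ofReal_mul' (half_pos hT).le]
        congr 1
        ring
    _ ≤ ∫⁻ t in Icc (T / 2) T, ENNReal.ofReal (Real.exp (t * (lam n).im)) *
        (‖a‖ₑ * ENNReal.ofReal (w n)) := by
        refine setLIntegral_mono' measurableSet_Icc fun t ht => mul_le_mul_left ?_ _
        exact ENNReal.ofReal_le_ofReal (Real.exp_le_exp.2 (mul_le_mul_of_nonneg_right ht.1 hn))
    _ ≤ _ := lintegral_mono_set (Icc_subset_Icc_left (half_pos hT).le)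

/-! ## The test sequence -/

/-- The multi-index `(k, 0, …, 0)`. -/
def firstIndex {d : ℕ} (hd : 0 < d) (k : ℕ) : MultiIndex d := Pi.single ⟨0, hd⟩ k

lemma len_firstIndex {d : ℕ} (hd : 0 < d) (k : ℕ) : len (firstIndex hd k) = k := by
  simp [len, firstIndex]

/-- The formal series `e^{-s} l_n`. -/
def expSingle {d : ℕ} (n : MultiIndex d) (s : ℝ) : FormalSeries d :=
  Pi.single n (Real.exp (-s) : ℂ)

lemma seriesNorm_expSingle {d : ℕ} (w : MultiIndex d → ℝ) (n : MultiIndex d) (s : ℝ) :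
    (seriesNorm w).toFun (expSingle n s) = ENNReal.ofReal (Real.exp (-s) * w n) := by
  rw [expSingle, seriesNorm_single, ← ofReal_norm, Complex.norm_real,
    Real.norm_of_nonneg (Real.exp_pos _).le, ← ENNReal.ofReal_mul (Real.exp_pos _).le]

lemma toReal_seriesNorm_growWeight_expSingle {d : ℕ} (α : ℝ) (h : Ioi (0 : ℝ)) (n : MultiIndex d)
    (s : ℝ) : ((seriesNorm (growWeight d α h)).toFun (expSingle n s)).toReal =
      Real.exp (h * (len n : ℝ) ^ (1 / α) - s) := by
  rw [seriesNorm_expSingle, growWeight, ← Real.exp_add, ENNReal.toReal_ofReal (Real.exp_pos _).le]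
  ring_nf

/-- A balance of exponents: `A` is lost to the smallness of the datum, `B` to the weight of the
target norm, and `Tδk^r/2` is gained from the growth on `[T/2, T]`. -/
lemma tendsto_pathNorm_propagator_atTop {d : ℕ} (hd : 0 < d) {T : ℝ} (hT : 0 < T)
    {lam : MultiIndex d → ℂ} {δ r : ℝ} (hδ : 0 < δ)
    (hlam : ∀ᶠ k : ℕ in atTop, ∀ n : MultiIndex d, len n = k → δ * (k : ℝ) ^ r ≤ (lam n).im)
    {w : MultiIndex d → ℝ} {A B : ℕ → ℝ} (hw : ∀ k, Real.exp (-B k) ≤ w (firstIndex hd k))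
    (hAB : Tendsto (fun k : ℕ => T / 2 * δ * (k : ℝ) ^ r - (A k + B k)) atTop atTop) :
    Tendsto (fun k => ((pathNorm d T w).toFun
      (propagator T lam (expSingle (firstIndex hd k) (A k)))).toReal) atTop atTop := by
  refine tendsto_atTop_mono' atTop ?_
    ((Real.tendsto_exp_atTop.comp hAB).const_mul_atTop (half_pos hT))
  filter_upwards [hlam] with k hk
  have h1 := hk _ (len_firstIndex hd k)
  have h0 : 0 ≤ (lam (firstIndex hd k)).im := le_trans (by positivity) h1
  refine le_trans ?_ (le_pathNorm_propagator_single hT w h0 _)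
  rw [Complex.norm_real, Real.norm_of_nonneg (Real.exp_pos _).le]
  have e : T / 2 * δ * (k : ℝ) ^ r - (A k + B k) =
      T / 2 * (δ * (k : ℝ) ^ r) + (-A k + -B k) := by ring
  rw [Function.comp, e, Real.exp_add, Real.exp_add, ← mul_assoc]
  gcongr
  exact hw k

lemma propagator_zero {d : ℕ} (T : ℝ) (lam : MultiIndex d → ℂ) : propagator T lam 0 = 0 := by
  refine AEEqFun.ext ?_
  filter_upwards [AEEqFun.coeFn_mk (μ := volume.restrict (Icc 0 T))
      (fun (t : ℝ) n => Complex.exp (-(Complex.I * (t : ℂ) * lam n)) * (0 : FormalSeries d) n)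
      (Continuous.aestronglyMeasurable (by fun_prop)),
    AEEqFun.coeFn_zero (α := ℝ) (β := FormalSeries d) (μ := volume.restrict (Icc 0 T))]
    with t h1 h2
  rw [propagator, h1, h2]
  funext n
  simp

lemma tendsto_rpow_sub_two_mul_atTop {κ γ r : ℝ} (hκ : 0 < κ) (h : γ < r) (hr : 0 < r) :
    Tendsto (fun k : ℕ => κ * (k : ℝ) ^ r - ((k : ℝ) ^ γ + (k : ℝ) ^ γ)) atTop atTop :=
  tendsto_sub_atTop_of_isLittleO ((tendsto_natCast_rpow_atTop hr).const_mul_atTop hκ)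
    (((isLittleO_natCast_rpow h).add (isLittleO_natCast_rpow h)).trans_isBigO
      (Asymptotics.isBigO_self_const_mul hκ.ne' _ _))

lemma Schwartz.coeff_zero (d : ℕ) : (0 : Schwartz d).coeff = 0 := by
  simpa using coeff_smul (0 : ℂ) (0 : Schwartz d)

lemma exp_neg_le_decayWeight {d : ℕ} (hd : 0 < d) (γ : ℝ) (k : ℕ) :
    Real.exp (-(k : ℝ) ^ γ) ≤ decayWeight d (1 / γ) ⟨1, mem_Ioi.2 one_pos⟩ (firstIndex hd k) := by
  rw [decayWeight_one_div, one_mul, len_firstIndex]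

/-! ### Discontinuity for the three pairs of spaces -/

theorem discontinuous_schwartz {d : ℕ} (hd : 0 < d) {r T : ℝ} (hr : 0 < r) (hT : 0 < T)
    {lam : MultiIndex d → ℂ} {δ : ℝ} (hδ : 0 < δ)
    (hlam : ∀ᶠ k : ℕ in atTop, ∀ n : MultiIndex d, len n = k → δ * (k : ℝ) ^ r ≤ (lam n).im) :
    DiscontinuousFromTo (X := Schwartz d) (Y := L1Tempered d T)
      (IndLimit.emb _) (fun f => propagator T lam f.coeff) := by
  obtain ⟨γ, hγ, hγr⟩ := exists_between hr
  have hmem : ∀ (N : Ioi (0 : ℝ)) (n : MultiIndex d) (s : ℝ),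
      ((pathNorm d T (polyWeight d N)).restrict (temperedPaths d T)).toFun
        (propagator T lam (expSingle n s)) < ⊤ := by
    intro N n s
    have ht : propagator T lam (expSingle n s) ∈ temperedPaths d T := by
      change ∀ᵐ t ∂_, _
      filter_upwards [coeFn_propagator_single T lam n (Real.exp (-s) : ℂ)] with t ht
      rw [expSingle, ht]
      exact single_mem_temperedSeries _ _
    simp only [ExtSeminorm.restrict, if_pos ht]
    exact pathNorm_propagator_single_lt_top T lam _ n _
  refine discontinuousFromTo_of_tendsto (IndLimit.emb_injective _)
    (x := fun k => (Real.exp (-(k : ℝ) ^ γ) : ℂ) • laguerre (firstIndex hd k))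
    (Schwartz.tendsto_zero fun p => ?_)
    (y := fun k => IndLimit.mk _ ⟨1, mem_Ioi.2 one_pos⟩ (hmem _ (firstIndex hd k) ((k : ℝ) ^ γ)))
    (fun k => ?_) (y₀ := 0) ?_
    (IndLimit.continuous_toReal _ (P := pathNorm d T (decayWeight d (1 / γ) ⟨1, mem_Ioi.2 one_pos⟩))
      fun N => ?_) ?_
  · obtain ⟨C, M, hC, h⟩ := exists_bound_schwartzSeminorm_laguerre p
    -- The seminorm of the test function is at most `C (k+1)^M e^{-k^γ}`, and `M log(k+1)` is
    -- negligible against `k^γ`.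
    have h0 := (tendsto_exp_sub_nhds_zero (tendsto_natCast_rpow_atTop hγ)
      ((isLittleO_log_natCast_add_one hγ).const_mul_left (M : ℝ))).const_mul C
    rw [mul_zero] at h0
    refine squeeze_zero (fun k => apply_nonneg _ _) (fun k => ?_) h0
    rw [map_smul_eq_mul, Complex.norm_real, Real.norm_of_nonneg (Real.exp_pos _).le, sub_eq_add_neg,
      Real.exp_add, mul_comm, ← mul_assoc]
    refine mul_le_mul_of_nonneg_right ((h _).trans_eq ?_) (Real.exp_pos _).le
    rw [len_firstIndex, Real.exp_nat_mul, Real.exp_log (by positivity)]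
  · rw [IndLimit.emb_mk, coeff_smul, coeff_laguerre, expSingle, ← Pi.single_smul, smul_eq_mul,
      mul_one]
  · rw [Schwartz.coeff_zero, propagator_zero]
    rfl
  · obtain ⟨C, hC⟩ := exists_decayWeight_le_polyWeight d hγ N
    refine ⟨C.toNNReal, fun G => (pathNorm_le (fun n => by unfold polyWeight; positivity)
      hC G).trans (mul_le_mul_right ?_ _)⟩
    -- Off the tempered paths the restricted norm is infinite and nothing is to be shown.
    by_cases hG : G ∈ temperedPaths d T
    · simp [ExtSeminorm.restrict, hG]
    · simp [ExtSeminorm.restrict, hG]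
  · exact tendsto_pathNorm_propagator_atTop hd hT hδ hlam (exp_neg_le_decayWeight hd γ)
      (tendsto_rpow_sub_two_mul_atTop (by positivity) hγr hr)

theorem discontinuous_beurling {d : ℕ} (hd : 0 < d) {r T : ℝ} (hr : 0 < r) (hT : 0 < T)
    {lam : MultiIndex d → ℂ} {δ : ℝ} (hδ : 0 < δ)
    (hlam : ∀ᶠ k : ℕ in atTop, ∀ n : MultiIndex d, len n = k → δ * (k : ℝ) ^ r ≤ (lam n).im)
    {α : ℝ} (hα : 1 / r < α) :
    DiscontinuousFromTo (X := GBeurling d α) (Y := L1DualBeurling d T α)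
      (IndLimit.emb _) (fun f => propagator T lam (ProjLimit.emb _ f)) := by
  have hα0 : 0 < α := (one_div_pos.2 hr).trans hα
  -- `γ > 1/α` makes `e^{-k^γ}` beat `e^{hk^{1/α}}` for every `h`, both in `X` and in comparing the
  -- weights on `Y`; `γ < r` leaves the growth dominant.
  obtain ⟨γ, hγ, hγr⟩ := exists_between ((one_div_lt hr hα0).1 hα)
  have hγ0 : 0 < γ := (one_div_pos.2 hα0).trans hγ
  have hfin : ∀ (n : MultiIndex d) (s : ℝ) (h : Ioi (0 : ℝ)),
      (seriesNorm (growWeight d α h)).toFun (expSingle n s) < ⊤ := fun n s h => by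
    rw [seriesNorm_expSingle]; exact ENNReal.ofReal_lt_top
  refine discontinuousFromTo_of_tendsto (IndLimit.emb_injective _)
    (x := fun k => ProjLimit.mk _ (hfin (firstIndex hd k) ((k : ℝ) ^ γ)))
    (ProjLimit.tendsto_zero _ fun h => ?_)
    (y := fun k => IndLimit.mk _ ⟨1, mem_Ioi.2 one_pos⟩
      (pathNorm_propagator_single_lt_top T lam _ (firstIndex hd k) (Real.exp (-(k : ℝ) ^ γ) : ℂ)))
    (fun k => rfl) (y₀ := 0) (propagator_zero T lam).symm
    (IndLimit.continuous_toReal _ (P := pathNorm d T (decayWeight d (1 / γ) ⟨1, mem_Ioi.2 one_pos⟩))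
      fun h => ?_) ?_
  · simp only [ProjLimit.emb_mk, toReal_seriesNorm_growWeight_expSingle, len_firstIndex]
    exact tendsto_exp_sub_nhds_zero (tendsto_natCast_rpow_atTop hγ0)
      ((isLittleO_natCast_rpow hγ).const_mul_left _)
  · obtain ⟨C, hC⟩ := exists_decayWeight_le_decayWeight d hγ hγ0 h
    exact ⟨C.toNNReal, pathNorm_le (fun n => (Real.exp_pos _).le) hC⟩
  · exact tendsto_pathNorm_propagator_atTop hd hT hδ hlam (exp_neg_le_decayWeight hd γ)
      (tendsto_rpow_sub_two_mul_atTop (by positivity) hγr hr)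

theorem discontinuous_roumieu {d : ℕ} (hd : 0 < d) {r T : ℝ} (hr : 0 < r) (hT : 0 < T)
    {lam : MultiIndex d → ℂ} {δ : ℝ} (hδ : 0 < δ)
    (hlam : ∀ᶠ k : ℕ in atTop, ∀ n : MultiIndex d, len n = k → δ * (k : ℝ) ^ r ≤ (lam n).im)
    {α : ℝ} (hα : 1 / r ≤ α) :
    DiscontinuousFromTo (X := GRoumieu d α) (Y := L1DualRoumieu d T α)
      (ProjLimit.emb _) (fun f => propagator T lam (IndLimit.emb _ f)) := by
  have hα0 : 0 < α := (one_div_pos.2 hr).trans_le hα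
  have hαr : 1 / α ≤ r := (one_div_le hr hα0).1 hα
  have hα1 : 0 < 1 / α := one_div_pos.2 hα0
  -- Datum and target weight each lose `εk^{1/α}`, together `Tδk^{1/α}/4`; this is at most half of
  -- the gain `Tδk^r/2` when `k ≥ 1`, also for `1/α = r`.
  set ε : ℝ := T * δ / 8 with hε
  have hε0 : 0 < ε := by positivity
  have hfin : ∀ (n : MultiIndex d) (s : ℝ) (h : Ioi (0 : ℝ)),
      (seriesNorm (growWeight d α h)).toFun (expSingle n s) < ⊤ := fun n s h => by
    rw [seriesNorm_expSingle]; exact ENNReal.ofReal_lt_top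
  refine discontinuousFromTo_of_tendsto (ProjLimit.emb_injective _)
    -- In the step of index `ε/2` the norm of the datum is `e^{-εk^{1/α}/2}`, which tends to zero;
    -- one step suffices for convergence in the union.
    (x := fun k => IndLimit.mk _ ⟨ε / 2, half_pos hε0⟩
      (hfin (firstIndex hd k) (ε * (k : ℝ) ^ (1 / α)) _))
    (IndLimit.tendsto_zero _ ⟨ε / 2, half_pos hε0⟩ (fun k => hfin _ _ _) ?_)
    (y := fun k => ProjLimit.mk _ fun h => pathNorm_propagator_single_lt_top T lam _
      (firstIndex hd k) (Real.exp (-(ε * (k : ℝ) ^ (1 / α))) : ℂ))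
    (fun k => rfl) (y₀ := 0) (propagator_zero T lam).symm
    (ProjLimit.continuous_toReal _ ⟨ε, hε0⟩) ?_
  · simp only [IndLimit.emb_mk, toReal_seriesNorm_growWeight_expSingle, len_firstIndex]
    refine Real.tendsto_exp_atBot.comp ?_
    have h1 := (tendsto_natCast_rpow_atTop hα1).const_mul_atTop_of_neg
      (neg_neg_of_pos (half_pos hε0))
    refine h1.congr fun k => ?_
    ring
  · refine tendsto_pathNorm_propagator_atTop hd hT hδ hlam
      (B := fun k : ℕ => ε * (k : ℝ) ^ (1 / α)) (fun k => ?_) ?_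
    · rw [decayWeight, len_firstIndex]
    · refine tendsto_atTop_mono' atTop ?_
        ((tendsto_natCast_rpow_atTop hr).const_mul_atTop (show 0 < T * δ / 4 by positivity))
      filter_upwards [eventually_ge_atTop 1] with k hk
      have h1 : (k : ℝ) ^ (1 / α) ≤ (k : ℝ) ^ r :=
        Real.rpow_le_rpow_of_exponent_le (by exact_mod_cast hk) hαr
      have h2 := mul_le_mul_of_nonneg_left h1 hε0.le
      rw [hε] at h2 ⊢
      linarith

end LaguerreOrthant

end

/-! ### The theorem, from the growth of the symbol alone -/

open LaguerreOrthant in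
theorem theorem4p1 (d : ℕ) (hd : 0 < d) (r T : ℝ) (hr : 0 < r) (hT : 0 < T) (ρ c : ℂ)
    (hρ : 0 < ρ.im) (lam : MultiIndex d → ℂ)
    (hlam : lam = scaledPowerSymbol d r ρ c ∨
      (0 < (ρ ^ (r : ℂ)).im ∧ lam = fullPowerSymbol d r ρ c)) :
    (DiscontinuousFromTo (X := Schwartz d) (Y := L1Tempered d T)
        (IndLimit.emb _) (fun f => propagator T lam f.coeff) ∧
      ∀ F : ℝ → FormalSeries d,
        ¬ WellPosed (X := Schwartz d) (Y := L1Tempered d T) T lam F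
          Schwartz.coeff (IndLimit.emb _)) ∧
    (∀ α : ℝ, 1 / r < α →
      DiscontinuousFromTo (X := GBeurling d α) (Y := L1DualBeurling d T α)
        (IndLimit.emb _) (fun f => propagator T lam (ProjLimit.emb _ f)) ∧
      ∀ F : ℝ → FormalSeries d,
        ¬ WellPosed (X := GBeurling d α) (Y := L1DualBeurling d T α) T lam F
          (ProjLimit.emb _) (IndLimit.emb _)) ∧
    (∀ α : ℝ, 1 / r ≤ α →
      DiscontinuousFromTo (X := GRoumieu d α) (Y := L1DualRoumieu d T α)
        (ProjLimit.emb _) (fun f => propagator T lam (IndLimit.emb _ f)) ∧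
      ∀ F : ℝ → FormalSeries d,
        ¬ WellPosed (X := GRoumieu d α) (Y := L1DualRoumieu d T α) T lam F
          (IndLimit.emb _) (ProjLimit.emb _)) := by
  obtain ⟨δ, hδ, him⟩ := exists_eventually_le_im_symbol hρ hlam
  refine ⟨⟨discontinuous_schwartz hd hr hT hδ him, ?_⟩,
    fun α hα => ⟨discontinuous_beurling hd hr hT hδ him hα, ?_⟩,
    fun α hα => ⟨discontinuous_roumieu hd hr hT hδ him hα, ?_⟩⟩
  · exact not_wellPosed_of_discontinuous hT (Schwartz.coeff_zero d) (IndLimit.emb_sub _)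
      (discontinuous_schwartz hd hr hT hδ him)
  · exact not_wellPosed_of_discontinuous hT rfl (IndLimit.emb_sub _)
      (discontinuous_beurling hd hr hT hδ him hα)
  · exact not_wellPosed_of_discontinuous hT rfl (ProjLimit.emb_sub _)
      (discontinuous_roumieu hd hr hT hδ him hα)
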